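/- Let $\mathbb S^1=\mathbb R/\mathbb Z$, let $R_\alpha(x)=x+\alpha \bmod 1$, and let $\mathcal H^\infty$ be the group of orientation-preserving $C^\infty$ diffeomorphisms of $\mathbb S^1$ with the metric $$d_\infty(f,g)=\sum_{k\ge 1}\frac{d_k(f,g)}{2^k(1+d_k(f,g))},\qquad d_k(f,g)=\max\{\|f-g\|_k,\|f^{-1}-g^{-1}\|_k\},\qquad \|f\|_k=\max_{0\le i\le k}\max_x|D^if(x)|.$$ Let $d\ge 1$, and let $\mathcal A$ be the space of free $\mathbb Z^d$ actions by elements of $\mathcal H^\infty$, that is, of homomorphisms $\phi:\mathbb Z^d\to\mathcal H^\infty$ such that $\phi(k)$ has no fixed point for $k\ne 0$, with the topology of pointwise convergence on $\mathbb Z^d$. Two actions $\phi,\psi$ are conjugate by an orientation-preserving homeomorphism $h$ of $\mathbb S^1$ if $\psi(k)=h\circ\phi(k)\circ h^{-1}$ for all $k\in\mathbb Z^d$. They are $C^\infty$-conjugate if $h$ can be chosen in $\mathcal H^\infty$, and Hölder-conjugate if $h$ can be chosen $\beta$-Hölder continuous for some $\beta\in(0,1)$. Then there is a continuous injective map $\Phi:\{0,1\}^{\mathbb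 N}\to\mathcal A$ such that for all sequences $a=(a_n)$ and $b=(b_n)$: (R1) if there is $N$ with $a_n=b_n$ for every $n\ge N$, then $\Phi(a)$ and $\Phi(b)$ are $C^\infty$-conjugate; (R2) if $a_n\ne b_n$ for infinitely many $n$, then $\Phi(a)$ and $\Phi(b)$ are not Hölder-conjugate. Moreover, $\Phi$ can be chosen so that the generators of the actions are simultaneous limits of the approximation-by-conjugation (AbC) method in the following sense. There are positive integers $q_n$ and integers $p^{(i)}_n$ coprime to $q_n$ ($n\ge 1$, $1\le i\le d$), real numbers $\alpha^{(1)},\dots,\alpha^{(d)}$ with $p^{(i)}_n/q_n\to\alpha^{(i)}$ as $n\to\infty$, and diffeomorphisms $h_{n,0},h_{n,1}\in\mathcal H^\infty$ that commute with $R_{1/q_n}$ such that, with $H_{a,0}=\mathrm{id}$ and $H_{a,n}=H_{a,n-1}\circ h_{n,a_n}$, for every $a\in\{0,1\}^{\mathbb N}$ and every $i$ the diffeomorphisms $$H_{a,n}\circ R_{p^{(i)}_{n+1}/q_{n+1}}\circ H_{a,n}^{-1}$$ converge in $\mathcal H^\infty$, as $n\to\infty$, to the $i$-th generator $\Phi(a)(e_i)$.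 This generator has rotation number $\alpha^{(i)} \bmod 1$, and the numbers $1,\alpha^{(1)},\dots,\alpha^{(d)}$ are linearly independent over $\mathbb Q$. -/

import Mathlib

open Filter Topology
open scoped ContDiff NNReal

namespace CircleActions

/-- The circle `ℝ / ℤ` with its quotient metric. -/
abbrev S1 : Type := UnitAddCircle

/-- `F` is a lift of the circle map `f`: a continuous increasing map of the line with
`F (x + 1) = F x + 1` that covers `f`. -/
def IsLift (F : CircleDeg1Lift) (f : S1 → S1) : Prop :=
  Continuous F ∧ ∀ x : ℝ, ((F x : ℝ) : S1) = f (x : S1)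

/-- Orientation-preserving circle homeomorphisms: those with an increasing lift. -/
def IsOrientationPreserving (f : S1 ≃ₜ S1) : Prop :=
  ∃ F : CircleDeg1Lift, IsLift F f

/-- The circle map `f` has a lift of class `C^∞`. -/
def HasSmoothLift (f : S1 → S1) : Prop :=
  ∃ F : CircleDeg1Lift, IsLift F f ∧ ContDiff ℝ ∞ F

theorem HasSmoothLift.comp {f g : S1 → S1} (hf : HasSmoothLift f) (hg : HasSmoothLift g) :
    HasSmoothLift (f ∘ g) := by
  obtain ⟨F, ⟨hFc, hF⟩, hFs⟩ := hf
  obtain ⟨G, ⟨hGc, hG⟩, hGs⟩ := hg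
  refine ⟨F * G, ⟨?_, fun x => ?_⟩, ?_⟩
  · rw [CircleDeg1Lift.coe_mul]; exact hFc.comp hGc
  · rw [CircleDeg1Lift.mul_apply, hF, hG]; rfl
  · rw [CircleDeg1Lift.coe_mul]; exact hFs.comp hGs

theorem hasSmoothLift_id : HasSmoothLift (fun x => x) :=
  ⟨1, ⟨by rw [CircleDeg1Lift.coe_one]; exact continuous_id, fun _ => rfl⟩,
    by rw [CircleDeg1Lift.coe_one]; exact contDiff_id⟩

theorem hasSmoothLift_add (α : ℝ) : HasSmoothLift (fun x => x + (α : S1)) := by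
  refine ⟨⟨⟨fun x => x + α, fun x y h => by simpa using h⟩, fun x => ?_⟩,
    ⟨?_, fun x => ?_⟩, ?_⟩
  · change x + 1 + α = x + α + 1
    ring
  · exact continuous_id.add continuous_const
  · exact AddCircle.coe_add 1 x α
  · exact contDiff_id.add contDiff_const

/-- The group of orientation-preserving `C^∞` diffeomorphisms of the circle, as a subgroup of the
group of homeomorphisms (multiplication is composition). -/
def smoothSubgroup : Subgroup (S1 ≃ₜ S1) where
  carrier := {f | HasSmoothLift f ∧ HasSmoothLift f.symm}
  mul_mem' := fun hf hg => ⟨hf.1.comp hg.1, hg.2.comp hf.2⟩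
  one_mem' := ⟨hasSmoothLift_id, hasSmoothLift_id⟩
  inv_mem' := fun hf => ⟨hf.2, hf.1⟩

/-- The type of orientation-preserving `C^∞` diffeomorphisms of the circle. -/
def Diffeo : Type := ↥smoothSubgroup

noncomputable section

namespace Diffeo

instance : Group Diffeo := inferInstanceAs (Group ↥smoothSubgroup)

/-- The underlying homeomorphism. -/
def toHomeo : Diffeo →* (S1 ≃ₜ S1) := smoothSubgroup.subtype

instance : CoeFun Diffeo (fun _ => S1 → S1) := ⟨fun f => f.toHomeo⟩

theorem ext {f g : Diffeo} (h : ∀ x, f x = g x) : f = g :=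
  Subtype.ext (Homeomorph.ext h)

theorem hasSmoothLift (f : Diffeo) : HasSmoothLift f := f.2.1

/-- A smooth lift of `f` (unique up to adding an integer constant). -/
def lift (f : Diffeo) : CircleDeg1Lift := Classical.choose f.hasSmoothLift

theorem isLift_lift (f : Diffeo) : IsLift f.lift f := (Classical.choose_spec f.hasSmoothLift).1

theorem contDiff_lift (f : Diffeo) : ContDiff ℝ ∞ f.lift :=
  (Classical.choose_spec f.hasSmoothLift).2

/-- The derivatives of positive order do not depend on the chosen lift. -/
theorem iteratedDeriv_lift {f : Diffeo} {F : CircleDeg1Lift} (hF : IsLift F f) (i : ℕ) (x : ℝ) :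
    iteratedDeriv (i + 1) f.lift x = iteratedDeriv (i + 1) F x := by
  have hint : ∀ y : ℝ, ∃ m : ℤ, f.lift y - F y = m := by
    intro y
    have h := (f.isLift_lift.2 y).trans (hF.2 y).symm
    rw [← sub_eq_zero, ← AddCircle.coe_sub, AddCircle.coe_eq_zero_iff] at h
    obtain ⟨m, hm⟩ := h
    exact ⟨m, by simpa using hm.symm⟩
  choose m hm using hint
  have hc : Continuous fun y => ((m y : ℤ) : ℝ) := by
    have h := f.isLift_lift.1.sub hF.1
    exact h.congr hm
  have hm' : Continuous m := Int.isClosedEmbedding_coe_real.isEmbedding.continuous_iff.2 hc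
  have hconst : ∀ y, m y = m 0 := fun y => PreconnectedSpace.constant inferInstance hm'
  have e : (f.lift : ℝ → ℝ) = fun y => F y + (m 0 : ℝ) := by
    funext y
    have h := hm y
    rw [hconst y] at h
    linarith
  rw [iteratedDeriv_succ', iteratedDeriv_succ', e]
  congr 1
  funext y
  exact deriv_add_const _

/-- The `i`-th derivative `D^i f` at (the class of) `x`, for `i ≥ 1`. -/
def derivAt (i : ℕ) (f : Diffeo) (x : ℝ) : ℝ := iteratedDeriv i f.lift x

/-- `max_x |D^i (f - g) (x)|`; for `i = 0` the difference is measured in the circle. -/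
def derivDist : ℕ → Diffeo → Diffeo → ℝ
  | 0, f, g => ⨆ x : S1, dist (f x) (g x)
  | i + 1, f, g => ⨆ x : ℝ, |derivAt (i + 1) f x - derivAt (i + 1) g x|

/-- `‖f - g‖_k = max_{0 ≤ i ≤ k} max_x |D^i (f - g) (x)|`. -/
def normDiff (k : ℕ) (f g : Diffeo) : ℝ :=
  (Finset.range (k + 1)).sup' Finset.nonempty_range_add_one (fun i => derivDist i f g)

/-- `d_k (f, g) = max {‖f - g‖_k, ‖f⁻¹ - g⁻¹‖_k}`. -/
def dk (k : ℕ) (f g : Diffeo) : ℝ := max (normDiff k f g) (normDiff k f⁻¹ g⁻¹)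

/-- `d_∞ (f, g) = ∑_{k ≥ 1} d_k (f, g) / (2 ^ k (1 + d_k (f, g)))`. -/
def dInf (f g : Diffeo) : ℝ :=
  ∑' k : ℕ, dk (k + 1) f g / (2 ^ (k + 1) * (1 + dk (k + 1) f g))

theorem continuous_derivAt (i : ℕ) (f : Diffeo) : Continuous (derivAt i f) :=
  f.contDiff_lift.continuous_iteratedDeriv i (by exact_mod_cast le_top)

theorem periodic_derivAt (i : ℕ) (f : Diffeo) : Function.Periodic (derivAt (i + 1) f) 1 := by
  intro x
  have h := iteratedDeriv_comp_add_const (i + 1) (f.lift : ℝ → ℝ) 1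
  have h' : (fun z => f.lift (z + 1)) = fun z => f.lift z + 1 := by
    funext z; exact f.lift.map_add_one z
  rw [h'] at h
  have h2 := congrFun h x
  have h3 : iteratedDeriv (i + 1) (fun z => f.lift z + 1) x
      = iteratedDeriv (i + 1) f.lift x := by
    rw [iteratedDeriv_succ', iteratedDeriv_succ']
    congr 1
    funext y
    exact deriv_add_const _
  exact h2.symm.trans h3

theorem bdd_zero (f g : Diffeo) : BddAbove (Set.range fun x : S1 => dist (f x) (g x)) :=
  (isCompact_range (f.toHomeo.continuous.dist g.toHomeo.continuous)).bddAbove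

theorem bdd_succ (i : ℕ) (f g : Diffeo) :
    BddAbove (Set.range fun x : ℝ => |derivAt (i + 1) f x - derivAt (i + 1) g x|) := by
  have hp : Function.Periodic (fun x : ℝ => |derivAt (i + 1) f x - derivAt (i + 1) g x|) 1 :=
    fun x => by simp only [periodic_derivAt i f x, periodic_derivAt i g x]
  exact (hp.compact_of_continuous one_ne_zero
    ((continuous_derivAt _ f).sub (continuous_derivAt _ g)).abs).bddAbove

theorem derivDist_self (i : ℕ) (f : Diffeo) : derivDist i f f = 0 := by
  cases i <;> simp [derivDist]

theorem derivDist_comm (i : ℕ) (f g : Diffeo) : derivDist i f g = derivDist i g f := by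
  cases i with
  | zero => simp only [derivDist, dist_comm]
  | succ i => simp only [derivDist, abs_sub_comm]

theorem derivDist_triangle (i : ℕ) (f g h : Diffeo) :
    derivDist i f h ≤ derivDist i f g + derivDist i g h := by
  cases i with
  | zero =>
    exact ciSup_le fun x => (dist_triangle _ (g x) _).trans
      (add_le_add (le_ciSup (bdd_zero f g) x) (le_ciSup (bdd_zero g h) x))
  | succ i =>
    exact ciSup_le fun x => (abs_sub_le _ (derivAt (i + 1) g x) _).trans
      (add_le_add (le_ciSup (bdd_succ i f g) x) (le_ciSup (bdd_succ i g h) x))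

theorem normDiff_self (k : ℕ) (f : Diffeo) : normDiff k f f = 0 := by
  simp [normDiff, derivDist_self]

theorem normDiff_comm (k : ℕ) (f g : Diffeo) : normDiff k f g = normDiff k g f := by
  simp only [normDiff, derivDist_comm _ f g]

theorem derivDist_le_normDiff {i k : ℕ} (h : i ≤ k) (f g : Diffeo) :
    derivDist i f g ≤ normDiff k f g :=
  Finset.le_sup' (fun i => derivDist i f g) (Finset.mem_range.2 (Nat.lt_succ_of_le h))

theorem normDiff_triangle (k : ℕ) (f g h : Diffeo) :
    normDiff k f h ≤ normDiff k f g + normDiff k g h :=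
  Finset.sup'_le _ _ fun i hi => by
    have hi' : i ≤ k := Nat.lt_succ_iff.1 (Finset.mem_range.1 hi)
    exact (derivDist_triangle i f g h).trans
      (add_le_add (derivDist_le_normDiff hi' f g) (derivDist_le_normDiff hi' g h))

theorem dk_self (k : ℕ) (f : Diffeo) : dk k f f = 0 := by simp [dk, normDiff_self]

theorem dk_comm (k : ℕ) (f g : Diffeo) : dk k f g = dk k g f := by
  simp only [dk, normDiff_comm k f g, normDiff_comm k f⁻¹ g⁻¹]

theorem dk_triangle (k : ℕ) (f g h : Diffeo) : dk k f h ≤ dk k f g + dk k g h :=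
  max_le
    ((normDiff_triangle k f g h).trans (add_le_add (le_max_left _ _) (le_max_left _ _)))
    ((normDiff_triangle k f⁻¹ g⁻¹ h⁻¹).trans (add_le_add (le_max_right _ _) (le_max_right _ _)))

theorem dk_nonneg (k : ℕ) (f g : Diffeo) : 0 ≤ dk k f g := by
  have h := dk_triangle k f g f
  rw [dk_self, dk_comm k g f] at h
  linarith

theorem term_nonneg (k : ℕ) (f g : Diffeo) :
    0 ≤ dk (k + 1) f g / (2 ^ (k + 1) * (1 + dk (k + 1) f g)) := by
  have := dk_nonneg (k + 1) f g
  positivity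

theorem term_le (k : ℕ) (f g : Diffeo) :
    dk (k + 1) f g / (2 ^ (k + 1) * (1 + dk (k + 1) f g)) ≤ (1 / 2) ^ k := by
  have h := dk_nonneg (k + 1) f g
  rw [div_le_iff₀ (by positivity)]
  have h2 : (1 / 2 : ℝ) ^ k * (2 ^ (k + 1) * (1 + dk (k + 1) f g))
      = 2 * (1 + dk (k + 1) f g) := by
    rw [pow_succ, one_div, inv_pow]; field_simp
  rw [h2]; linarith

theorem summable_term (f g : Diffeo) :
    Summable fun k : ℕ => dk (k + 1) f g / (2 ^ (k + 1) * (1 + dk (k + 1) f g)) :=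
  Summable.of_nonneg_of_le (fun k => term_nonneg k f g) (fun k => term_le k f g)
    summable_geometric_two

theorem term_triangle (k : ℕ) (f g h : Diffeo) :
    dk (k + 1) f h / (2 ^ (k + 1) * (1 + dk (k + 1) f h)) ≤
      dk (k + 1) f g / (2 ^ (k + 1) * (1 + dk (k + 1) f g)) +
      dk (k + 1) g h / (2 ^ (k + 1) * (1 + dk (k + 1) g h)) := by
  have ha := dk_nonneg (k + 1) f g
  have hb := dk_nonneg (k + 1) g h
  have hc := dk_nonneg (k + 1) f h
  have ht := dk_triangle (k + 1) f g h
  generalize dk (k + 1) f g = a at *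
  generalize dk (k + 1) g h = b at *
  generalize dk (k + 1) f h = c at *
  have key : c / (1 + c) ≤ a / (1 + a) + b / (1 + b) := by
    rw [div_add_div _ _ (by positivity) (by positivity), div_le_div_iff₀ (by positivity)
      (by positivity)]
    nlinarith [mul_nonneg ha hb, mul_nonneg (mul_nonneg ha hb) hc]
  have e : ∀ t : ℝ, t / (2 ^ (k + 1) * (1 + t)) = (1 / 2 ^ (k + 1)) * (t / (1 + t)) := by
    intro t; rw [div_mul_div_comm, one_mul]
  rw [e, e, e, ← mul_add]
  exact mul_le_mul_of_nonneg_left key (by positivity)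

/-- The `C^∞` topology, given by the metric `d_∞`. -/
instance : MetricSpace Diffeo where
  dist := dInf
  dist_self f := by simp [dInf, dk_self]
  dist_comm f g := by simp only [dInf, dk_comm _ f g]
  dist_triangle f g h := by
    unfold dInf
    rw [← (summable_term f g).tsum_add (summable_term g h)]
    exact (summable_term f h).tsum_le_tsum (fun k => term_triangle k f g h)
      ((summable_term f g).add (summable_term g h))
  eq_of_dist_eq_zero := by
    intro f g h
    change dInf f g = 0 at h
    have hs := (summable_term f g).hasSum
    rw [show ∑' k : ℕ, dk (k + 1) f g / (2 ^ (k + 1) * (1 + dk (k + 1) f g)) = 0 from h] at hs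
    have h0 := (hasSum_zero_iff_of_nonneg (fun k => term_nonneg k f g)).1 hs
    have h1 := congrFun h0 0
    have hn := dk_nonneg (0 + 1) f g
    have h2 : dk (0 + 1) f g = 0 := by
      rcases div_eq_zero_iff.1 h1 with h | h
      · exact h
      · exact absurd h (by positivity)
    refine ext fun x => dist_le_zero.1 ?_
    calc dist (f x) (g x) ≤ derivDist 0 f g := le_ciSup (bdd_zero f g) x
      _ ≤ normDiff (0 + 1) f g := derivDist_le_normDiff (Nat.zero_le _) f g
      _ ≤ dk (0 + 1) f g := le_max_left _ _
      _ = 0 := h2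

/-- The rotation `R_α : x ↦ x + α mod 1`. -/
def rotation (α : ℝ) : Diffeo :=
  ⟨Homeomorph.addRight (α : S1), hasSmoothLift_add α, by
    have h := hasSmoothLift_add (-α)
    rw [AddCircle.coe_neg] at h
    exact h⟩

end Diffeo

/-- The circle homeomorphism `f` has rotation number `ρ`, that is, `ρ` is the class modulo `1` of
the translation number `lim (F^n x - x) / n` of a lift `F` of `f`. -/
def HasRotationNumber (f : S1 → S1) (ρ : S1) : Prop :=
  ∃ F : CircleDeg1Lift, IsLift F f ∧ ((F.translationNumber : ℝ) : S1) = ρ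

/-- A free `ℤ^d` action by orientation-preserving `C^∞` diffeomorphisms of the circle: no
non-trivial element has a fixed point. -/
structure FreeAction (d : ℕ) where
  toHom : Multiplicative (Fin d → ℤ) →* Diffeo
  free : ∀ k : Fin d → ℤ, k ≠ 0 → ∀ x : S1, toHom (Multiplicative.ofAdd k) x ≠ x

namespace FreeAction

variable {d : ℕ}

/-- The diffeomorphism by which `k ∈ ℤ^d` acts. -/
def act (φ : FreeAction d) (k : Fin d → ℤ) : Diffeo := φ.toHom (Multiplicative.ofAdd k)

/-- The `i`-th generator of the action. -/
def generator (φ : FreeAction d) (i : Fin d) : Diffeo := φ.act (Pi.single i 1)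

/-- Actions are close when finitely many group elements act by `C^∞`-close diffeomorphisms. -/
instance : TopologicalSpace (FreeAction d) :=
  TopologicalSpace.induced (fun φ => φ.act) (inferInstanceAs (TopologicalSpace
    ((Fin d → ℤ) → Diffeo)))

/-- Conjugacy of actions by an orientation-preserving `C^∞` diffeomorphism. -/
def SmoothConj (φ ψ : FreeAction d) : Prop :=
  ∃ h : Diffeo, ∀ k, ψ.act k = h * φ.act k * h⁻¹

/-- Conjugacy of actions by an orientation-preserving homeomorphism that is `β`-Hölder for some
`0 < β < 1`. -/
def HolderConj (φ ψ : FreeAction d) : Prop :=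
  ∃ h : S1 ≃ₜ S1, IsOrientationPreserving h ∧
    (∃ β C : ℝ≥0, 0 < β ∧ β < 1 ∧ HolderWith C β h) ∧
    ∀ k, (ψ.act k).toHomeo = h * (φ.act k).toHomeo * h⁻¹

end FreeAction

/-- Data of `d` simultaneous approximation-by-conjugation (AbC) constructions, one for every
sequence in `{0,1}^ℕ`: denominators `q n` and numerators `p i n`, and for each `n` and each symbol
a `C^∞` diffeomorphism that commutes with the rotation by `1 / q n`. -/
structure AbCData (d : ℕ) where
  q : ℕ → ℕ
  q_pos : ∀ n, 0 < q n
  p : Fin d → ℕ → ℤ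
  coprime : ∀ i n, IsCoprime (p i n) (q n : ℤ)
  h : ℕ → Bool → Diffeo
  commute : ∀ n s, h n s * Diffeo.rotation (1 / (q n : ℝ)) = Diffeo.rotation (1 / (q n : ℝ)) * h n s

namespace AbCData

variable {d : ℕ}

/-- The rational rotation angle `p i n / q n`. -/
def angle (D : AbCData d) (i : Fin d) (n : ℕ) : ℝ := (D.p i n : ℝ) / (D.q n : ℝ)

/-- The conjugation maps `H_0 = id`, `H_{n+1} = H_n ∘ h_n`, where `h_n` is selected by `a n`. -/
def conj (D : AbCData d) (a : ℕ → Bool) : ℕ → Diffeo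
  | 0 => 1
  | n + 1 => D.conj a n * D.h n (a n)

/-- The `n`-th approximation `H_n ∘ R ∘ H_n⁻¹` of the `i`-th generator, where `R` is the rotation
by `p i n / q n`; the same `H_n` serves all `i`. -/
def approx (D : AbCData d) (a : ℕ → Bool) (i : Fin d) (n : ℕ) : Diffeo :=
  D.conj a n * Diffeo.rotation (D.angle i n) * (D.conj a n)⁻¹

end AbCData

end

end CircleActions

namespace CircleActions

noncomputable section

/-! At step n the symbol 0 contributes the identity and the symbol 1 a diffeomorphism h commuting
with R_{1/q}, where q is the common denominator of the current rational angle vector θ. Then (H h)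
R_θ (H h)⁻¹ = H R_θ H⁻¹, so inserting h changes nothing until θ moves. The later angles are confined
so close to θ that the conjugated rotations change by at most 2^{-n} in C^n, for all of the finitely
many possible H at once (`eventually_conj_shift_close`, `Stage.exists_succ`). The actions converge
in C^∞ at a rate independent of a, while H_{a,n} is only shown to converge in C^0, to a
homeomorphism U_a with Φ(a) = U_a R_α U_a⁻¹. Since α satisfies no integer relation with 1, the
action is free.

If a and b have the same tail, U_b = B U_a with B smooth, which gives (R1). In general a conjugacy
from Φ(a) to Φ(b) is U_b R_t U_a⁻¹ for some t, because only rotations commute with an irrational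
rotation.

For (R2), `exists_swap` takes h = g R_{1/(2q)} g⁻¹, where g squeezes alternate arcs: h sends a short
arc to a long one, and back again since h² = R_{1/q}. Where a_n ≠ b_n, exactly one of the two
constructions inserts h. Earlier maps distort by amounts fixed before h is chosen, and later maps
move points too little to matter. So the conjugacy carries two points at distance at most
(η/(n+2))^{n+1} to points at distance at least η (`exists_distorted`). The unknown t is harmless:
the side with the identity is controlled by distances alone, which translations preserve. Infinitely
many such n defeat every Hölder bound; a single one already defeats the identity, whence
injectivity. -/

theorem dist_coe_le (x y : ℝ) : dist (x : S1) (y : S1) ≤ |x - y| := by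
  rw [dist_eq_norm, ← AddCircle.coe_sub]
  exact QuotientAddGroup.norm_mk_le_norm

/-! ### Lifts and the circle maps they cover -/

theorem continuous_lift_unit (u : CircleDeg1Liftˣ) : Continuous (u : ℝ → ℝ) := by
  rw [← CircleDeg1Lift.coe_toOrderIso]
  exact (CircleDeg1Lift.toOrderIso u).continuous

/-- The circle map covered by a degree one lift. -/
def circleMap (F : CircleDeg1Lift) : S1 → S1 :=
  Function.Periodic.lift (f := fun x : ℝ => ((F x : ℝ) : S1)) (c := 1) fun x => by
    simp only [F.map_add_one]
    exact AddCircle.coe_add_period 1 (F x)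

theorem continuous_circleMap {F : CircleDeg1Lift} (hF : Continuous F) :
    Continuous (circleMap F) :=
  continuous_quot_lift _ ((AddCircle.continuous_mk' 1).comp hF)

theorem circleMap_mul (F G : CircleDeg1Lift) (x : S1) :
    circleMap (F * G) x = circleMap F (circleMap G x) := by
  induction x using QuotientAddGroup.induction_on with
  | H x => rfl

theorem circleMap_one (x : S1) : circleMap 1 x = x := by
  induction x using QuotientAddGroup.induction_on with
  | H x => rfl

/-- The circle homeomorphism covered by an invertible degree one lift. -/
def circleHomeo : CircleDeg1Liftˣ →* (S1 ≃ₜ S1) where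
  toFun u :=
    { toFun := circleMap u
      invFun := circleMap (u⁻¹ : CircleDeg1Liftˣ)
      left_inv := fun x => by rw [← circleMap_mul, Units.inv_mul, circleMap_one]
      right_inv := fun x => by rw [← circleMap_mul, Units.mul_inv, circleMap_one]
      continuous_toFun := continuous_circleMap (continuous_lift_unit u)
      continuous_invFun := continuous_circleMap (continuous_lift_unit u⁻¹) }
  map_one' := Homeomorph.ext circleMap_one
  map_mul' u v := Homeomorph.ext fun x => circleMap_mul u v x

theorem circleHomeo_coe (u : CircleDeg1Liftˣ) (x : ℝ) :
    circleHomeo u (x : S1) = ((u x : ℝ) : S1) := rfl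

theorem isLift_circleHomeo (u : CircleDeg1Liftˣ) : IsLift u (circleHomeo u) :=
  ⟨continuous_lift_unit u, fun _ => rfl⟩

/-- Invertible degree one lifts that are smooth together with their inverse. -/
def smoothUnits : Subgroup CircleDeg1Liftˣ where
  carrier := {u | ContDiff ℝ ∞ (u : ℝ → ℝ) ∧ ContDiff ℝ ∞ ((u⁻¹ : CircleDeg1Liftˣ) : ℝ → ℝ)}
  mul_mem' {u v} hu hv := by
    refine ⟨hu.1.comp hv.1, ?_⟩
    rw [mul_inv_rev]
    exact hv.2.comp hu.2
  one_mem' := ⟨contDiff_id, by rw [inv_one]; exact contDiff_id⟩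
  inv_mem' {u} hu := ⟨hu.2, by rw [inv_inv]; exact hu.1⟩

/-- The circle diffeomorphism covered by a smooth invertible lift. -/
def toDiffeo : smoothUnits →* Diffeo where
  toFun u := ⟨circleHomeo u, ⟨(u : CircleDeg1Liftˣ), isLift_circleHomeo u, u.2.1⟩,
    ⟨((u⁻¹ : smoothUnits) : CircleDeg1Liftˣ), isLift_circleHomeo (u⁻¹ : smoothUnits), u.2.2⟩⟩
  map_one' := Subtype.ext (map_one circleHomeo)
  map_mul' u v := Subtype.ext (map_mul circleHomeo (u : CircleDeg1Liftˣ) v)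

theorem toHomeo_toDiffeo (u : smoothUnits) : (toDiffeo u).toHomeo = circleHomeo u := rfl

theorem isLift_toDiffeo (u : smoothUnits) : IsLift (u : CircleDeg1Liftˣ) (toDiffeo u) :=
  isLift_circleHomeo u

/-! ### The metric `d_∞` in terms of lifts -/

theorem derivDist_toDiffeo_le {u v : smoothUnits} {i : ℕ} {ε : ℝ}
    (h : ∀ x, |iteratedDeriv i (u : CircleDeg1Liftˣ) x
      - iteratedDeriv i (v : CircleDeg1Liftˣ) x| ≤ ε) :
    Diffeo.derivDist i (toDiffeo u) (toDiffeo v) ≤ ε := by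
  cases i with
  | zero =>
    refine ciSup_le fun x => ?_
    induction x using QuotientAddGroup.induction_on with
    | H x =>
      refine (dist_coe_le _ _).trans ?_
      simpa only [iteratedDeriv_zero] using h x
  | succ i =>
    refine ciSup_le fun x => ?_
    rw [Diffeo.derivAt, Diffeo.derivAt, Diffeo.iteratedDeriv_lift (isLift_toDiffeo u),
      Diffeo.iteratedDeriv_lift (isLift_toDiffeo v)]
    exact h x

/-- The first n terms of the series contribute at most ε ∑ 2^{-k} = 2ε; the remaining ones at most 2
· 2^{-n}, whatever the maps are. -/
theorem dist_toDiffeo_le {u v : smoothUnits} {n : ℕ} {ε : ℝ} (hε : 0 ≤ ε)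
    (h : ∀ i ≤ n, ∀ x, |iteratedDeriv i (u : CircleDeg1Liftˣ) x
      - iteratedDeriv i (v : CircleDeg1Liftˣ) x| ≤ ε)
    (h' : ∀ i ≤ n, ∀ x, |iteratedDeriv i (u⁻¹ : smoothUnits).1 x
      - iteratedDeriv i (v⁻¹ : smoothUnits).1 x| ≤ ε) :
    dist (toDiffeo u) (toDiffeo v) ≤ 2 * ε + 2 * (1 / 2) ^ n := by
  have hdk : ∀ k ≤ n, Diffeo.dk k (toDiffeo u) (toDiffeo v) ≤ ε := by
    intro k hk
    have hi : ∀ i ∈ Finset.range (k + 1), i ≤ n := fun i hi =>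
      (Nat.lt_succ_iff.1 (Finset.mem_range.1 hi)).trans hk
    refine max_le (Finset.sup'_le _ _ fun i hik => derivDist_toDiffeo_le (h i (hi i hik)))
      (Finset.sup'_le _ _ fun i hik => ?_)
    rw [← map_inv, ← map_inv]
    exact derivDist_toDiffeo_le (h' i (hi i hik))
  set t : ℕ → ℝ := fun k => Diffeo.dk (k + 1) (toDiffeo u) (toDiffeo v) /
    (2 ^ (k + 1) * (1 + Diffeo.dk (k + 1) (toDiffeo u) (toDiffeo v))) with ht
  have hs : Summable t := Diffeo.summable_term _ _
  change ∑' k, t k ≤ _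
  rw [← hs.sum_add_tsum_nat_add n]
  refine add_le_add ?_ ?_
  · have h1 : ∀ k ∈ Finset.range n, t k ≤ ε * (1 / 2) ^ k := by
      intro k hk
      have hkn := hdk (k + 1) (Finset.mem_range.1 hk)
      have h0 := Diffeo.dk_nonneg (k + 1) (toDiffeo u) (toDiffeo v)
      simp only [ht]
      generalize Diffeo.dk (k + 1) (toDiffeo u) (toDiffeo v) = a at *
      rw [div_le_iff₀ (by positivity)]
      have h2 : ε * (1 / 2 : ℝ) ^ k * (2 ^ (k + 1) * (1 + a)) = 2 * ε * (1 + a) := by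
        rw [pow_succ, one_div, inv_pow]; field_simp
      rw [h2]; nlinarith [mul_nonneg hε h0]
    refine (Finset.sum_le_sum h1).trans ?_
    rw [← Finset.mul_sum, mul_comm]
    refine mul_le_mul_of_nonneg_right ?_ hε
    exact (summable_geometric_two.sum_le_tsum _ fun _ _ => by positivity).trans_eq
      tsum_geometric_two
  · have h1 : ∀ k, t (k + n) ≤ (1 / 2) ^ k * (1 / 2) ^ n := fun k => by
      rw [← pow_add]; exact Diffeo.term_le _ _ _
    refine (((summable_nat_add_iff n).2 hs).tsum_le_tsum h1
      (summable_geometric_two.mul_right _)).trans_eq ?_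
    rw [tsum_mul_right, tsum_geometric_two]

/-! ### Translations -/

/-- Translation by `t` as a smooth invertible lift. -/
def shift (t : ℝ) : smoothUnits :=
  ⟨CircleDeg1Lift.translate (Multiplicative.ofAdd t), by
    constructor
    · have : ((CircleDeg1Lift.translate (Multiplicative.ofAdd t) : CircleDeg1Liftˣ) : ℝ → ℝ)
        = fun x => t + x := funext fun x => CircleDeg1Lift.translate_apply t x
      rw [this]; exact contDiff_const.add contDiff_id
    · have : (((CircleDeg1Lift.translate (Multiplicative.ofAdd t))⁻¹ : CircleDeg1Liftˣ) : ℝ → ℝ)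
        = fun x => -t + x := funext fun x => CircleDeg1Lift.translate_inv_apply t x
      rw [this]; exact contDiff_const.add contDiff_id⟩

theorem shift_apply (t x : ℝ) : (shift t : CircleDeg1Liftˣ) x = x + t :=
  (CircleDeg1Lift.translate_apply t x).trans (add_comm _ _)

theorem shift_add (s t : ℝ) : shift (s + t) = shift s * shift t :=
  Subtype.ext ((congrArg _ (ofAdd_add s t)).trans (map_mul _ _ _))

theorem shift_zero : shift 0 = 1 :=
  Subtype.ext ((congrArg _ ofAdd_zero).trans (map_one _))

theorem shift_neg (t : ℝ) : shift (-t) = (shift t)⁻¹ := by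
  rw [eq_inv_iff_mul_eq_one, ← shift_add, neg_add_cancel, shift_zero]

theorem shift_zpow (t : ℝ) (m : ℤ) : shift t ^ m = shift (m * t) := by
  refine Subtype.ext ?_
  change CircleDeg1Lift.translate (Multiplicative.ofAdd t) ^ m = _
  rw [CircleDeg1Lift.translate_zpow]; rfl

theorem toDiffeo_shift (t : ℝ) : toDiffeo (shift t) = Diffeo.rotation t := by
  refine Diffeo.ext fun x => ?_
  induction x using QuotientAddGroup.induction_on with
  | H x =>
    change (((shift t : CircleDeg1Liftˣ) x : ℝ) : S1) = (x : S1) + (t : S1)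
    rw [shift_apply, AddCircle.coe_add]

theorem circleHomeo_shift (t : ℝ) (x : S1) :
    circleHomeo (shift t : CircleDeg1Liftˣ) x = x + (t : S1) := by
  change toDiffeo (shift t) x = _
  rw [toDiffeo_shift]
  rfl

/-! ### Smooth limits and dependence on the rotation angle -/

/-- The controlled order of differentiation grows with n, so each fixed derivative is eventually
Cauchy at a geometric rate, and uniform limits of derivatives are derivatives of the limit. -/
theorem contDiff_of_iteratedDeriv_geometric {f : ℕ → ℝ → ℝ} {g : ℝ → ℝ} {N : ℕ}
    (hf : ∀ n, ContDiff ℝ ∞ (f n)) (hlim : ∀ x, Tendsto (fun n => f n x) atTop (𝓝 (g x)))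
    (h : ∀ i n, N ≤ n → i ≤ n → ∀ x,
      |iteratedDeriv i (f (n + 1)) x - iteratedDeriv i (f n) x| ≤ (1 / 2) ^ n) :
    ContDiff ℝ ∞ g ∧ ∀ i n, N ≤ n → i ≤ n → ∀ x,
      |iteratedDeriv i g x - iteratedDeriv i (f n) x| ≤ 2 * (1 / 2) ^ n := by
  have hstep : ∀ i n, N ≤ n → i ≤ n → ∀ x m,
      dist (iteratedDeriv i (f (m + n)) x) (iteratedDeriv i (f (m + 1 + n)) x)
        ≤ 2 * (1 / 2) ^ n / 2 / 2 ^ m := by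
    intro i n hN hi x m
    rw [dist_comm, Real.dist_eq, add_right_comm m 1 n]
    refine (h i (m + n) (hN.trans (Nat.le_add_left _ _)) (hi.trans (Nat.le_add_left _ _)) x).trans_eq
      ?_
    rw [pow_add, one_div, inv_pow]
    field_simp
  have hex : ∀ i x, ∃ y, Tendsto (fun n => iteratedDeriv i (f n) x) atTop (𝓝 y) := by
    intro i x
    obtain ⟨y, hy⟩ := cauchySeq_tendsto_of_complete (cauchySeq_of_le_geometric_two
      (hstep i (max N i) (le_max_left _ _) (le_max_right _ _) x))
    exact ⟨y, (tendsto_add_atTop_iff_nat _).1 hy⟩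
  choose G hG using hex
  have hbound : ∀ i n, N ≤ n → i ≤ n → ∀ x,
      |G i x - iteratedDeriv i (f n) x| ≤ 2 * (1 / 2) ^ n := by
    intro i n hN hi x
    have := dist_le_of_le_geometric_two_of_tendsto₀ (hstep i n hN hi x)
      ((tendsto_add_atTop_iff_nat n).2 (hG i x))
    rwa [zero_add, dist_comm, Real.dist_eq] at this
  have hunif : ∀ i, TendstoUniformly (fun n => iteratedDeriv i (f n)) (G i) atTop := by
    intro i
    rw [Metric.tendstoUniformly_iff]
    intro ε hε
    have h0 : Tendsto (fun n : ℕ => 2 * (1 / 2 : ℝ) ^ n) atTop (𝓝 (2 * 0)) :=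
      (tendsto_pow_atTop_nhds_zero_of_lt_one (by norm_num) (by norm_num)).const_mul 2
    rw [mul_zero] at h0
    filter_upwards [h0.eventually (gt_mem_nhds hε), eventually_ge_atTop N, eventually_ge_atTop i]
      with n h1 h2 h3 x
    exact (hbound i n h2 h3 x).trans_lt h1
  have hder : ∀ i x, HasDerivAt (G i) (G (i + 1) x) x := by
    intro i x
    refine hasDerivAt_of_tendstoUniformly (hunif (i + 1)) (Eventually.of_forall fun n y => ?_)
      (hG i) x
    rw [iteratedDeriv_succ]
    exact (((hf n).differentiable_iteratedDeriv i (by exact_mod_cast ENat.natCast_lt_top i)) y).hasDerivAt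
  have hiter : ∀ i, iteratedDeriv i g = G i := by
    intro i
    induction i with
    | zero =>
      rw [iteratedDeriv_zero]
      funext x
      refine tendsto_nhds_unique (hlim x) ?_
      simpa only [iteratedDeriv_zero] using hG 0 x
    | succ i ih =>
      rw [iteratedDeriv_succ, ih]
      funext x
      exact (hder i x).deriv
  refine ⟨contDiff_of_differentiable_iteratedDeriv fun m _ => ?_, fun i n hN hi x => ?_⟩
  · rw [hiter]
    exact fun x => (hder m x).differentiableAt
  · rw [hiter]
    exact hbound i n hN hi x

/-- Induction over all G at once: differentiating the slice replaces G by its second partial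
derivative, which is again smooth. -/
theorem continuous_iteratedDeriv_slice (i : ℕ) : ∀ {G : ℝ × ℝ → ℝ}, ContDiff ℝ ∞ G →
    Continuous fun p : ℝ × ℝ => iteratedDeriv i (fun x => G (p.1, x)) p.2 := by
  induction i with
  | zero =>
    intro G hG
    simpa only [iteratedDeriv_zero] using hG.continuous
  | succ i ih =>
    intro G hG
    have h1 : ContDiff ℝ ∞ fun p => fderiv ℝ G p (0, 1) :=
      (hG.fderiv_right (m := ∞) (by simp)).clm_apply contDiff_const
    refine (ih h1).congr fun p => ?_
    rw [iteratedDeriv_succ']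
    congr 1
    funext x
    have h2 : HasDerivAt (fun x : ℝ => (p.1, x)) ((0 : ℝ), (1 : ℝ)) x :=
      (hasDerivAt_const x p.1).prodMk (hasDerivAt_id x)
    exact ((hG.differentiable (by simp) (p.1, x)).hasFDerivAt.comp_hasDerivAt x h2).deriv.symm

theorem periodic_iteratedDeriv_sub (i : ℕ) (F G : CircleDeg1Lift) :
    Function.Periodic (fun x => iteratedDeriv i F x - iteratedDeriv i G x) 1 := by
  cases i with
  | zero =>
    intro x
    simp only [iteratedDeriv_zero, CircleDeg1Lift.map_add_one]
    ring
  | succ i =>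
    have key : ∀ (F : CircleDeg1Lift) (x : ℝ),
        iteratedDeriv (i + 1) F (x + 1) = iteratedDeriv (i + 1) F x := by
      intro F x
      have h := congrFun (iteratedDeriv_comp_add_const (i + 1) (F : ℝ → ℝ) 1) x
      simp only [CircleDeg1Lift.map_add_one] at h
      rw [← h, iteratedDeriv_succ', iteratedDeriv_succ']
      congr 1
      funext y
      exact deriv_add_const _
    intro x
    simp only [key]

/-- The difference is jointly continuous in (s, x) and vanishes at s = s₀; compactness of [0, 1] and
periodicity make the bound uniform in x. -/
theorem eventually_conj_shift_close (A : smoothUnits) (i : ℕ) (s₀ : ℝ) {ε : ℝ} (hε : 0 < ε) :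
    ∀ᶠ s in 𝓝 s₀, ∀ x, |iteratedDeriv i (A * shift s * A⁻¹).1 x
      - iteratedDeriv i (A * shift s₀ * A⁻¹).1 x| ≤ ε := by
  have hG : ContDiff ℝ ∞ fun p : ℝ × ℝ => A.1 ((A⁻¹).1 p.2 + p.1) :=
    A.2.1.comp ((A.2.2.comp contDiff_snd).add contDiff_fst)
  have hA : ∀ s, (((A * shift s * A⁻¹).1 : CircleDeg1Lift) : ℝ → ℝ)
      = fun x => A.1 ((A⁻¹).1 x + s) :=
    fun s => funext fun x => congrArg A.1 (shift_apply s _)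
  have hc := continuous_iteratedDeriv_slice i hG
  have hc' : Continuous fun p : ℝ × ℝ => |iteratedDeriv i (A * shift p.1 * A⁻¹).1 p.2
      - iteratedDeriv i (A * shift s₀ * A⁻¹).1 p.2| := by
    simp only [hA]
    exact (hc.sub (hc.comp (continuous_const.prodMk continuous_snd))).abs
  have hev := isCompact_Icc.eventually_forall_of_forall_eventually (x₀ := s₀)
    (K := Set.Icc (0 : ℝ) 1)
    (P := fun s x => |iteratedDeriv i (A * shift s * A⁻¹).1 x
      - iteratedDeriv i (A * shift s₀ * A⁻¹).1 x| ≤ ε) fun y _ => by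
        refine (hc'.tendsto (s₀, y)).eventually_le_const ?_
        simpa using hε
  filter_upwards [hev] with s hs x
  obtain ⟨y, hy, hxy⟩ := (periodic_iteratedDeriv_sub i (A * shift s * A⁻¹).1
    (A * shift s₀ * A⁻¹).1).exists_mem_Ico₀ one_pos x
  rw [hxy]
  exact hs y (Set.Ico_subset_Icc_self hy)

/-! ### The Möbius contraction and the distorting map -/

theorem exists_smoothUnit_of_deriv_pos {F : CircleDeg1Lift} (hF : ContDiff ℝ ∞ F) {F' : ℝ → ℝ}
    (hF' : ∀ x, HasDerivAt F (F' x) x) (hpos : ∀ x, 0 < F' x) :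
    ∃ u : smoothUnits, ∀ x, u.1 x = F x := by
  have hbij : Function.Bijective F := ⟨(strictMono_of_hasDerivAt_pos hF' hpos).injective,
    F.continuous_iff_surjective.1 hF.continuous⟩
  obtain ⟨u, rfl⟩ := CircleDeg1Lift.isUnit_iff_bijective.2 hbij
  exact ⟨⟨u, hF, (CircleDeg1Lift.toOrderIso u).toHomeomorph.contDiff_symm_deriv
    (fun x => (hpos x).ne') hF' hF⟩, fun _ => rfl⟩

/-- The lift of the Möbius transformation of the unit circle with parameter `r`. -/
def moebius (r x : ℝ) : ℝ :=
  x + Real.arctan (r * Real.sin (2 * Real.pi * x) / (1 - r * Real.cos (2 * Real.pi * x))) / Real.pi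

theorem moebius_add_one (r x : ℝ) : moebius r (x + 1) = moebius r x + 1 := by
  simp only [moebius, mul_add, mul_one, Real.sin_add_two_pi, Real.cos_add_two_pi]
  ring

theorem one_sub_mul_cos_pos {r : ℝ} (h0 : 0 ≤ r) (h1 : r < 1) (y : ℝ) :
    0 < 1 - r * Real.cos y := by
  nlinarith [Real.cos_le_one y]

theorem contDiff_moebius {r : ℝ} (h0 : 0 ≤ r) (h1 : r < 1) : ContDiff ℝ ∞ (moebius r) := by
  have hl : ContDiff ℝ ∞ fun x : ℝ => 2 * Real.pi * x := contDiff_const.mul contDiff_id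
  exact contDiff_id.add ((Real.contDiff_arctan.comp
    ((contDiff_const.mul (Real.contDiff_sin.comp hl)).div
      (contDiff_const.sub (contDiff_const.mul (Real.contDiff_cos.comp hl)))
      fun x => (one_sub_mul_cos_pos h0 h1 _).ne')).div_const _)

/-- The map lifts z ↦ (z - r)/(1 - rz) on the unit circle; its derivative is the Poisson-type kernel
(1 - r²)/|1 - r e^{2πix}|². -/
theorem exists_hasDerivAt_moebius {r : ℝ} (h0 : 0 ≤ r) (h1 : r < 1) (x : ℝ) :
    ∃ m, 0 < m ∧ HasDerivAt (moebius r) m x := by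
  have hl : HasDerivAt (fun x : ℝ => 2 * Real.pi * x) (2 * Real.pi) x := by
    simpa using (hasDerivAt_id x).const_mul (2 * Real.pi)
  have hd := one_sub_mul_cos_pos h0 h1 (2 * Real.pi * x)
  have hder := (hasDerivAt_id x).add ((((hl.sin.const_mul r).div
    ((hl.cos.const_mul r).const_sub 1) hd.ne').arctan).div_const Real.pi)
  refine ⟨_, ?_, hder⟩
  set c := Real.cos (2 * Real.pi * x)
  set s := Real.sin (2 * Real.pi * x)
  have hsc : s ^ 2 + c ^ 2 = 1 := Real.sin_sq_add_cos_sq _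
  have hD : 0 < (1 - r * c) ^ 2 + (r * s) ^ 2 := by positivity
  have hr : 0 < 1 - r ^ 2 := by nlinarith
  have e : (1 - r ^ 2) / ((1 - r * c) ^ 2 + (r * s) ^ 2) =
      1 + 1 / (1 + (r * s / (1 - r * c)) ^ 2) * ((r * (c * (2 * Real.pi)) * (1 - r * c)
        - r * s * -(r * (-s * (2 * Real.pi)))) / (1 - r * c) ^ 2) / Real.pi := by
    have h2 : 1 + (r * s / (1 - r * c)) ^ 2
        = ((1 - r * c) ^ 2 + (r * s) ^ 2) / (1 - r * c) ^ 2 := by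
      field_simp
    rw [h2]
    have := Real.pi_pos
    field_simp
    linear_combination (r ^ 2) * hsc
  exact (div_pos hr hD).trans_eq e

/-- As r → 1 the Möbius map squeezes [1/4, 3/4] to length 1/2 - 2 arctan(r)/π → 0. Lifting it
through the q-fold cover, x ↦ `moebius r (q * x) / q`, makes it commute with translation by 1/q. -/
theorem exists_contracting {q : ℕ} (hq : 0 < q) {δ : ℝ} (hδ : 0 < δ) :
    ∃ g : smoothUnits, (∀ x, g.1 (x + 1 / q) = g.1 x + 1 / q) ∧
      g.1 (3 / (4 * q)) - g.1 (1 / (4 * q)) ≤ δ := by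
  have hq' : (0 : ℝ) < q := Nat.cast_pos.2 hq
  obtain ⟨r, h0, h1, hr⟩ : ∃ r : ℝ, 0 ≤ r ∧ r < 1 ∧
      1 / 2 - 2 * (Real.arctan r / Real.pi) ≤ q * δ := by
    have hc : Continuous fun r : ℝ => 1 / 2 - 2 * (Real.arctan r / Real.pi) := by fun_prop
    have ht : Tendsto (fun r : ℝ => 1 / 2 - 2 * (Real.arctan r / Real.pi)) (𝓝[<] 1) (𝓝 0) := by
      refine (hc.tendsto' 1 0 ?_).mono_left nhdsWithin_le_nhds
      rw [Real.arctan_one]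
      have := Real.pi_pos
      field_simp
      norm_num
    obtain ⟨r, h, h1, h2⟩ := ((ht.eventually_le_const (u := q * δ) (by positivity)).and
      ((eventually_mem_nhdsWithin).and
        ((lt_mem_nhds one_pos).filter_mono nhdsWithin_le_nhds))).exists
    exact ⟨r, le_of_lt h2, h1, h⟩
  choose m hm0 hm using exists_hasDerivAt_moebius h0 h1
  have hmono : StrictMono (moebius r) := strictMono_of_hasDerivAt_pos hm hm0
  have hper : ∀ x, moebius r (q * (x + 1 / q)) / q = moebius r (q * x) / q + 1 / q := by
    intro x
    rw [mul_add, mul_one_div_cancel hq'.ne', moebius_add_one, add_div]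
  have hper' : ∀ n : ℕ, ∀ x, moebius r (x + n) = moebius r x + n := by
    intro n x
    induction n with
    | zero => simp
    | succ n ih => rw [Nat.cast_succ, ← add_assoc, moebius_add_one, ih, add_assoc]
  let F : CircleDeg1Lift := ⟨⟨fun x => moebius r (q * x) / q, fun x y h => by
    have := hmono.monotone (mul_le_mul_of_nonneg_left h hq'.le)
    dsimp only
    gcongr⟩, fun x => by
      change moebius r (q * (x + 1)) / q = moebius r (q * x) / q + 1
      rw [mul_add, mul_one, hper', add_div, div_self hq'.ne']⟩
  have hF : ContDiff ℝ ∞ F :=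
    ((contDiff_moebius h0 h1).comp (contDiff_const.mul contDiff_id)).div_const _
  have hF' : ∀ x, HasDerivAt F (m (q * x) * q / q) x := by
    intro x
    have hl : HasDerivAt (fun x : ℝ => (q : ℝ) * x) q x := by
      simpa using (hasDerivAt_id x).const_mul (q : ℝ)
    exact ((hm (q * x)).comp x hl).div_const _
  obtain ⟨g, hg⟩ := exists_smoothUnit_of_deriv_pos hF hF' fun x => by
    have := hm0 (q * x); positivity
  refine ⟨g, fun x => ?_, ?_⟩
  · rw [hg, hg]
    exact hper x
  · rw [hg, hg]
    change moebius r (q * (3 / (4 * q))) / q - moebius r (q * (1 / (4 * q))) / q ≤ δ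
    have e1 : (q : ℝ) * (3 / (4 * q)) = 3 / 4 := by field_simp
    have e2 : (q : ℝ) * (1 / (4 * q)) = 1 / 4 := by field_simp
    have a1 : 2 * Real.pi * (3 / 4) = Real.pi / 2 + Real.pi := by ring
    have a2 : 2 * Real.pi * (1 / 4) = Real.pi / 2 := by ring
    rw [e1, e2, ← sub_div, div_le_iff₀ hq', mul_comm δ]
    refine le_of_eq_of_le ?_ hr
    simp only [moebius, a1, a2, Real.sin_add_pi, Real.cos_add_pi, Real.sin_pi_div_two,
      Real.cos_pi_div_two, mul_zero, neg_zero, sub_zero, div_one, mul_one, mul_neg,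
      Real.arctan_neg]
    ring

theorem dist_coe_eq {x y : ℝ} (h : |x - y| ≤ 1 / 2) : dist (x : S1) (y : S1) = |x - y| := by
  rw [dist_eq_norm, ← AddCircle.coe_sub]
  exact (AddCircle.norm_coe_eq_abs_iff 1 one_ne_zero).2 (by simpa using h)

/-- With h = g R_{1/(2q)} g⁻¹, the points g(1/(4q)) and g(3/(4q)) are close, while h moves them to
g(3/(4q)) and g(1/(4q)) + 1/q, the ends of the complementary long arc of a period. Since h² =
R_{1/q}, a second application makes them close again. Both directions are needed, because Hölder
continuity constrains only one direction of a conjugacy. -/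
theorem exists_swap {q : ℕ} (hq : 2 ≤ q) {δ : ℝ} (hδ : 0 < δ) :
    ∃ h : smoothUnits, Commute h (shift (1 / q)) ∧ (∀ x, |h.1 x - x| ≤ 1 / q) ∧
      (∀ x, |(h⁻¹).1 x - x| ≤ 1 / q) ∧
      ∃ x y : S1, dist x y ≤ δ ∧ 1 / (2 * q) ≤ dist (circleHomeo h x) (circleHomeo h y) ∧
        dist (circleHomeo h (circleHomeo h x)) (circleHomeo h (circleHomeo h y)) ≤ δ := by
  have hq0 : 0 < q := by omega
  have hq' : (0 : ℝ) < q := Nat.cast_pos.2 hq0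
  have hq2 : (2 : ℝ) ≤ q := by exact_mod_cast hq
  -- The bound 1/(2q) on the short arc leaves at least 1/(2q) for the long one.
  obtain ⟨g, hg, hgδ⟩ := exists_contracting hq0 (lt_min hδ (show (0 : ℝ) < 1 / (2 * q) by positivity))
  have hcomm : Commute g (shift (1 / q)) := by
    refine Subtype.ext (Units.ext (CircleDeg1Lift.ext fun x => ?_))
    change g.1 ((shift (1 / q)).1 x) = (shift (1 / q)).1 (g.1 x)
    rw [shift_apply, shift_apply, hg]
  set h : smoothUnits := g * shift (1 / (2 * q)) * g⁻¹ with hh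
  have hs : Commute (shift (1 / (2 * q))) (shift (1 / q)) := by
    rw [Commute, SemiconjBy, ← shift_add, ← shift_add, add_comm]
  have hhc : Commute h (shift (1 / q)) := (hcomm.mul_left hs).mul_left hcomm.inv_left
  have hhg : ∀ x, h.1 (g.1 x) = g.1 (x + 1 / (2 * q)) := by
    intro x
    change g.1 ((shift (1 / (2 * q))).1 ((g⁻¹).1 (g.1 x))) = _
    rw [shift_apply]
    congr 2
    exact CircleDeg1Lift.units_inv_apply_apply g.1 x
  have hgs : ∀ x, ∃ y, g.1 y = x := fun x => ⟨(g⁻¹).1 x, CircleDeg1Lift.units_apply_inv_apply g.1 x⟩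
  have hmono : Monotone g.1 := CircleDeg1Lift.monotone _
  have hle : (1 : ℝ) / (2 * q) ≤ 1 / q := by gcongr; linarith
  have h1 : ∀ x, |h.1 x - x| ≤ 1 / q := by
    intro x
    obtain ⟨y, rfl⟩ := hgs x
    rw [hhg, abs_le]
    have a := hmono (show y ≤ y + 1 / (2 * q) by simp)
    have b := hmono (show y + 1 / (2 * q) ≤ y + 1 / q by linarith)
    rw [hg] at b
    have : (0 : ℝ) < 1 / q := by positivity
    constructor <;> linarith
  have h2 : ∀ x, |(h⁻¹).1 x - x| ≤ 1 / q := by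
    intro x
    have := h1 ((h⁻¹).1 x)
    rwa [show h.1 ((h⁻¹).1 x) = x from CircleDeg1Lift.units_apply_inv_apply h.1 x,
      abs_sub_comm] at this
  have e1 : (1 : ℝ) / (4 * q) + 1 / (2 * q) = 3 / (4 * q) := by field_simp; norm_num
  have e2 : (3 : ℝ) / (4 * q) + 1 / (2 * q) = 1 / (4 * q) + 1 / q := by field_simp; norm_num
  have hmin := le_min_iff.1 hgδ
  have hpos := hmono (show (1 : ℝ) / (4 * q) ≤ 3 / (4 * q) by gcongr; norm_num)
  have hx : h.1 (g.1 (1 / (4 * q))) = g.1 (3 / (4 * q)) := by rw [hhg, e1]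
  have hy : h.1 (g.1 (3 / (4 * q))) = g.1 (1 / (4 * q)) + 1 / q := by rw [hhg, e2, hg]
  have hhx : h.1 (g.1 (1 / (4 * q)) + 1 / q) = g.1 (3 / (4 * q)) + 1 / q := by
    rw [← hg, hhg, add_right_comm, e1, hg]
  refine ⟨h, hhc, h1, h2, (g.1 (1 / (4 * q)) : ℝ), (g.1 (3 / (4 * q)) : ℝ), ?_, ?_, ?_⟩
  · refine (dist_coe_le _ _).trans ?_
    rw [abs_sub_comm, abs_of_nonneg (by linarith)]
    exact hmin.1
  · rw [circleHomeo_coe, circleHomeo_coe, hx, hy]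
    -- Here q ≥ 2 matters: the long arc has length at most 1/2, so its length is the circle
    -- distance.
    have hqq : (1 : ℝ) / q ≤ 1 / 2 := by gcongr
    have hhalf : (1 : ℝ) / q = 1 / (2 * q) + 1 / (2 * q) := by field_simp; norm_num
    rw [dist_comm, dist_coe_eq] <;> rw [abs_of_nonneg (by linarith)] <;> linarith
  · rw [circleHomeo_coe, circleHomeo_coe, hx, hy, circleHomeo_coe, circleHomeo_coe, hy, hhx]
    refine (dist_coe_le _ _).trans ?_
    rw [abs_sub_comm, abs_of_nonneg (by linarith)]
    linarith [hmin.1]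

/-! ### Rational and rationally independent angles -/

/-- The rotation angle of `k ∈ ℤ^d` when the generators have angles `θ`. -/
def pair {d : ℕ} (k : Fin d → ℤ) (θ : Fin d → ℝ) : ℝ := ∑ i, (k i : ℝ) * θ i

/-- The vectors in `ℤ^d` of sup norm at most `n`. -/
def box (d n : ℕ) : Finset (Fin d → ℤ) := Finset.Icc (fun _ => -(n : ℤ)) (fun _ => (n : ℤ))

variable {d : ℕ}

theorem continuous_pair (k : Fin d → ℤ) : Continuous (pair k) := by
  unfold pair; fun_prop

theorem pair_single (i : Fin d) (θ : Fin d → ℝ) : pair (Pi.single i 1) θ = θ i := by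
  simp [pair, Pi.single_apply]

theorem pair_add (k l : Fin d → ℤ) (θ : Fin d → ℝ) : pair (k + l) θ = pair k θ + pair l θ := by
  simp [pair, add_mul, Finset.sum_add_distrib]

theorem pair_neg (k : Fin d → ℤ) (θ : Fin d → ℝ) : pair (-k) θ = -pair k θ := by
  simp [pair]

theorem neg_mem_box {n : ℕ} {k : Fin d → ℤ} (h : k ∈ box d n) : -k ∈ box d n := by
  rw [box, Finset.mem_Icc] at h ⊢
  exact ⟨fun i => neg_le_neg (h.2 i), fun i => neg_le.1 (h.1 i)⟩

theorem exists_mem_box (k : Fin d → ℤ) : ∃ N, ∀ n, N ≤ n → k ∈ box d n := by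
  refine ⟨∑ i, (k i).natAbs, fun n hn => ?_⟩
  have h : ∀ i, |k i| ≤ n := fun i => by
    have h1 : (k i).natAbs ≤ n :=
      (Finset.single_le_sum (f := fun i => (k i).natAbs) (fun _ _ => Nat.zero_le _)
        (Finset.mem_univ i)).trans hn
    rw [Int.abs_eq_natAbs]
    exact_mod_cast h1
  rw [box, Finset.mem_Icc]
  exact ⟨fun i => (abs_le.1 (h i)).1, fun i => (abs_le.1 (h i)).2⟩

/-- Baire: countably many hyperplanes are removed, each with open dense complement. -/
theorem dense_pair_ne_int : Dense {θ : Fin d → ℝ | ∀ k, k ≠ 0 → ∀ m : ℤ, pair k θ ≠ m} := by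
  have hd : ∀ j : {k : Fin d → ℤ // k ≠ 0} × ℤ, Dense (pair j.1.1 ⁻¹' {(j.2 : ℝ)}ᶜ) := by
    rintro ⟨⟨k, hk⟩, m⟩
    obtain ⟨i, hi⟩ := Function.ne_iff.1 hk
    have hi' : (k i : ℝ) ≠ 0 := Int.cast_ne_zero.2 hi
    let L : (Fin d → ℝ) →ₗ[ℝ] ℝ := ∑ i, (k i : ℝ) • LinearMap.proj i
    have hL : ∀ θ, L θ = pair k θ := fun θ => by simp [L, pair]
    have hsurj : Function.Surjective L := fun t => ⟨Pi.single i (t / k i), by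
      rw [hL]
      simp only [pair, Pi.single_apply, mul_ite, mul_zero, Finset.sum_ite_eq', Finset.mem_univ,
        if_true]
      field_simp⟩
    have hopen := L.isOpenMap_of_finiteDimensional hsurj
    rw [show pair k = L from funext fun θ => (hL θ).symm]
    exact (dense_compl_singleton (m : ℝ)).preimage hopen
  have := dense_iInter_of_isOpen
    (fun j => isClosed_singleton.isOpen_compl.preimage (continuous_pair _)) hd
  refine this.mono fun θ hθ k hk m => ?_
  exact Set.mem_iInter.1 hθ (⟨k, hk⟩, m)

theorem isOpen_pair_ne_int (k : Fin d → ℤ) : IsOpen {θ : Fin d → ℝ | ∀ m : ℤ, pair k θ ≠ m} := by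
  have : {θ : Fin d → ℝ | ∀ m : ℤ, pair k θ ≠ m} = pair k ⁻¹' (Set.range ((↑) : ℤ → ℝ))ᶜ := by
    ext θ
    simp [eq_comm]
  rw [this]
  exact Int.isClosedEmbedding_coe_real.isClosed_range.isOpen_compl.preimage (continuous_pair k)

/-- Perturb to a relation-free β, then round it to a large prime denominator; the finitely many
conditions for `k ∈ box d n` are open, hence survive. -/
theorem exists_rational_angles (θ₀ : Fin d → ℝ) {s : Set (Fin d → ℝ)} (hs : s ∈ 𝓝 θ₀)
    (Q n : ℕ) : ∃ q : ℕ, Q ≤ q ∧ ∃ p : Fin d → ℤ, (∀ i, IsCoprime (p i) (q : ℤ)) ∧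
      (fun i => (p i : ℝ) / q) ∈ s ∧
      ∀ k ∈ box d n, k ≠ 0 → ∀ m : ℤ, pair k (fun i => (p i : ℝ) / q) ≠ m := by
  obtain ⟨β, hβ, hβs⟩ := dense_pair_ne_int.inter_nhds_nonempty (interior_mem_nhds.2 hs)
  have hlim : Tendsto (fun q : ℕ => fun i => (⌊β i * q⌋ : ℝ) / q) atTop (𝓝 β) := by
    refine tendsto_pi_nhds.2 fun i => ?_
    rw [tendsto_iff_dist_tendsto_zero]
    refine squeeze_zero' (Eventually.of_forall fun _ => dist_nonneg) ?_
      tendsto_one_div_atTop_nhds_zero_nat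
    filter_upwards [eventually_gt_atTop 0] with q hq
    have hq' : (0 : ℝ) < q := Nat.cast_pos.2 hq
    have h1 := Int.floor_le (β i * q)
    have h2 := Int.lt_floor_add_one (β i * q)
    rw [Real.dist_eq, abs_le]
    constructor
    · rw [neg_le_sub_iff_le_add, ← add_div, le_div_iff₀ hq']
      linarith
    · rw [sub_le_iff_le_add, div_le_iff₀ hq', add_mul, one_div_mul_cancel hq'.ne']
      linarith
  have hbox : ∀ᶠ θ in 𝓝 β, ∀ k ∈ box d n, k ≠ 0 → ∀ m : ℤ, pair k θ ≠ m := by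
    rw [Filter.eventually_all_finset]
    intro k _
    by_cases hk : k = 0
    · simp [hk]
    · filter_upwards [(isOpen_pair_ne_int k).mem_nhds (hβ k hk)] with θ hθ _ using hθ
  -- Non-integral coordinates mean that the prime q does not divide the numerators. This does not
  -- follow from `hbox`, since `box d 0` is {0}.
  have hsing : ∀ᶠ θ : Fin d → ℝ in 𝓝 β, ∀ i, ∀ m : ℤ, θ i ≠ (m : ℝ) := by
    rw [Filter.eventually_all]
    intro i
    have hi : (Pi.single i 1 : Fin d → ℤ) ≠ 0 := by simp
    filter_upwards [(isOpen_pair_ne_int (Pi.single i 1)).mem_nhds (hβ _ hi)] with θ hθ m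
    rw [← pair_single i θ]
    exact hθ m
  have hmem : ∀ᶠ θ in 𝓝 β, θ ∈ s := mem_interior_iff_mem_nhds.1 hβs
  obtain ⟨N, hN⟩ := eventually_atTop.1 (hlim.eventually (hmem.and (hbox.and hsing)))
  obtain ⟨q, hq, hprime⟩ := Nat.exists_infinite_primes (max N Q)
  obtain ⟨h1, h2, h3⟩ := hN q ((le_max_left _ _).trans hq)
  refine ⟨q, (le_max_right _ _).trans hq, fun i => ⌊β i * q⌋, fun i => ?_, h1, h2⟩
  refine ((Nat.prime_iff_prime_int.1 hprime).irreducible.coprime_iff_not_dvd.2 ?_).symm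
  rintro ⟨m, hm⟩
  refine h3 i m ?_
  change (⌊β i * q⌋ : ℝ) / q = m
  rw [show ⌊β i * q⌋ = q * m from hm]
  have : (q : ℝ) ≠ 0 := Nat.cast_ne_zero.2 hprime.ne_zero
  push_cast
  field_simp

/-! ### The inductive step -/

/-- The state of the inductive construction: the finitely many conjugating maps obtained so far, the
last denominator, numerators and commuting map, the radius `r` of the ball to which all later angles
are confined, and the distance `ε` within which later maps may move points. -/
structure Stage (d : ℕ) where
  maps : Set smoothUnits
  finite_maps : maps.Finite
  q : ℕ
  p : Fin d → ℤ
  h : smoothUnits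
  r : ℝ
  r_pos : 0 < r
  ε : ℝ
  ε_pos : 0 < ε

/-- The rational angles of a stage. -/
def Stage.θ (S : Stage d) : Fin d → ℝ := fun i => (S.p i : ℝ) / S.q

/-- The action of `k` conjugate by `A` to the rotations with angles `θ`. -/
def conjShift (A : smoothUnits) (k : Fin d → ℤ) (θ : Fin d → ℝ) : smoothUnits :=
  A * shift (pair k θ) * A⁻¹

/-- The map `h` distorts distances so much that its effect is seen through every map of `M`, even
after perturbations of size `ε`. -/
def Distorts (M : Set smoothUnits) (h : smoothUnits) (ε : ℝ) (n : ℕ) : Prop :=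
  ∃ η c δ : ℝ, 0 < η ∧ η ≤ 1 ∧ 4 * ε ≤ c ∧ 4 * ε ≤ δ ∧
    (∀ A ∈ M, ∀ x y : S1, c ≤ dist x y → η ≤ dist (circleHomeo A x) (circleHomeo A y)) ∧
    (∀ A ∈ M, ∀ x y : S1, dist x y ≤ 2 * δ →
      dist (circleHomeo A x) (circleHomeo A y) ≤ (η / (n + 2)) ^ (n + 1)) ∧
    ∃ x y : S1, dist x y ≤ δ ∧ 2 * c ≤ dist (circleHomeo h x) (circleHomeo h y) ∧
      dist (circleHomeo h (circleHomeo h x)) (circleHomeo h (circleHomeo h y)) ≤ δ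

/-- The stage `S'` is an admissible `n`-th successor of `S`. -/
structure Stage.Succ (n : ℕ) (S S' : Stage d) : Prop where
  q_pos : 0 < S'.q
  coprime : ∀ i, IsCoprime (S'.p i) (S'.q : ℤ)
  θ_mem : S'.θ ∈ Metric.closedBall S.θ (S.r / 2)
  r_le : S'.r ≤ S.r / 2
  ε_le : S'.ε ≤ S.ε / 2
  commute : Commute S'.h (shift (1 / S'.q))
  mem_maps : ∀ A ∈ S.maps, A ∈ S'.maps
  mul_mem_maps : ∀ A ∈ S.maps, A * S'.h ∈ S'.maps
  near : ∀ A ∈ S.maps, ∀ x, |(A * S'.h).1 x - A.1 x| ≤ (1 / 2) ^ n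
  near_inv : ∀ x, |(S'.h⁻¹).1 x - x| ≤ S.ε / 2
  free : ∀ θ ∈ Metric.closedBall S'.θ S'.r, ∀ k ∈ box d n, k ≠ 0 → ∀ m : ℤ, pair k θ ≠ m
  close : ∀ θ ∈ Metric.closedBall S'.θ S'.r, ∀ A ∈ S'.maps, ∀ k ∈ box d n,
    ∀ i ∈ Finset.range (n + 1), ∀ x, |iteratedDeriv i (conjShift A k θ).1 x
      - iteratedDeriv i (conjShift A k S'.θ).1 x| ≤ (1 / 2) ^ n
  distorts : Distorts S.maps S'.h S'.ε n

theorem exists_dist_le {M : Set smoothUnits} (hM : M.Finite) {κ : ℝ} (hκ : 0 < κ) :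
    ∃ δ > 0, ∀ A ∈ M, ∀ x y : S1, dist x y ≤ δ →
      dist (circleHomeo A x) (circleHomeo A y) ≤ κ := by
  have h : ∀ᶠ δ : ℝ in 𝓝[>] 0, ∀ A ∈ M, ∀ x y : S1, dist x y ≤ δ →
      dist (circleHomeo A x) (circleHomeo A y) ≤ κ := by
    rw [Filter.eventually_all_finite hM]
    intro A _
    obtain ⟨δ, hδ, hA⟩ := Metric.uniformContinuous_iff.1
      (CompactSpace.uniformContinuous_of_continuous (circleHomeo A.1).continuous) κ hκ
    filter_upwards [nhdsWithin_le_nhds (gt_mem_nhds hδ)] with δ' hδ' x y hxy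
    exact (hA (hxy.trans_lt hδ')).le
  obtain ⟨δ, h1, h2⟩ := (h.and eventually_mem_nhdsWithin).exists
  exact ⟨δ, h2, h1⟩

/-- Uniform continuity of the inverse maps. -/
theorem exists_le_dist {M : Set smoothUnits} (hM : M.Finite) {c : ℝ} (hc : 0 < c) :
    ∃ η > 0, ∀ A ∈ M, ∀ x y : S1, c ≤ dist x y →
      η ≤ dist (circleHomeo A x) (circleHomeo A y) := by
  obtain ⟨η, hη, h⟩ := exists_dist_le (hM.image fun A => A⁻¹) (half_pos hc)
  refine ⟨η, hη, fun A hA x y hxy => ?_⟩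
  by_contra! hlt
  have := h A⁻¹ ⟨A, hA, rfl⟩ _ _ hlt.le
  have e : ∀ z, circleHomeo (A⁻¹ : smoothUnits) (circleHomeo A z) = z := fun z => by
    rw [InvMemClass.coe_inv, map_inv]
    exact (circleHomeo A.1).symm_apply_apply z
  rw [e, e] at this
  linarith

/-- This is `eventually_conj_shift_close` for i = 0, s₀ = 0 read at A y, where the conjugated shift
gives A (y + s). -/
theorem eventually_shift_near (A : smoothUnits) {κ : ℝ} (hκ : 0 < κ) :
    ∀ᶠ t : ℝ in 𝓝 0, ∀ x y, |x - y| ≤ t → |A.1 x - A.1 y| ≤ κ := by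
  obtain ⟨r, hr, h⟩ := Metric.eventually_nhds_iff.1 (eventually_conj_shift_close A 0 0 hκ)
  filter_upwards [gt_mem_nhds hr] with t ht x y hxy
  have h1 := h (y := x - y) (by simpa using hxy.trans_lt ht) (A.1 y)
  have e : ∀ s, (A * shift s * A⁻¹).1 (A.1 y) = A.1 (y + s) := fun s => by
    change A.1 ((shift s).1 ((A⁻¹).1 (A.1 y))) = _
    rw [show (A⁻¹).1 (A.1 y) = y from CircleDeg1Lift.units_inv_apply_apply A.1 y, shift_apply]
  simpa only [iteratedDeriv_zero, e, add_zero, add_sub_cancel] using h1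

/-- The order of choices is what matters: q and θ, then c = 1/(4q), then η and δ from the old maps,
then h, and last r and ε, which must respect h. Large q makes h close to the identity in C^0,
however strongly it distorts. -/
theorem Stage.exists_succ (n : ℕ) (S : Stage d) : ∃ S' : Stage d, S.Succ n S' := by
  have hpow : (0 : ℝ) < (1 / 2) ^ n := by positivity
  have hnear : ∀ᶠ t : ℝ in 𝓝 0, ∀ A ∈ S.maps, ∀ x y, |x - y| ≤ t →
      |A.1 x - A.1 y| ≤ (1 / 2) ^ n :=
    (Filter.eventually_all_finite S.finite_maps).2 fun A _ => eventually_shift_near A hpow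
  obtain ⟨Q, hQ⟩ := eventually_atTop.1 (tendsto_one_div_atTop_nhds_zero_nat.eventually
    (hnear.and (ge_mem_nhds (half_pos S.ε_pos))))
  obtain ⟨q, hq, p, hcop, hθ, hfree⟩ := exists_rational_angles S.θ
    (Metric.closedBall_mem_nhds S.θ (half_pos S.r_pos)) (max 2 Q) n
  obtain ⟨hq1, hq2⟩ := hQ q ((le_max_right _ _).trans hq)
  have hqtwo : 2 ≤ q := (le_max_left _ _).trans hq
  have hqpos : (0 : ℝ) < q := by positivity
  -- The scale c = 1/(4q) is half the stretched distance 1/(2q) of `exists_swap`, leaving room for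
  -- later perturbations.
  obtain ⟨η', hη', hA1⟩ := exists_le_dist S.finite_maps (c := 1 / (4 * q)) (by positivity)
  set η := min η' 1 with hη
  have hηpos : 0 < η := lt_min hη' one_pos
  obtain ⟨δ', hδ', hA2⟩ := exists_dist_le S.finite_maps
    (κ := (η / (n + 2)) ^ (n + 1)) (by positivity)
  obtain ⟨h, hcomm, hh, hhinv, x, y, hxy, hhxy, hhhxy⟩ := exists_swap hqtwo (half_pos hδ')
  set M := S.maps ∪ (fun A => A * h) '' S.maps with hM
  have hMfin : M.Finite := S.finite_maps.union (S.finite_maps.image _)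
  set θ : Fin d → ℝ := fun i => (p i : ℝ) / q with hθdef
  have hclose : ∀ᶠ θ' in 𝓝 θ, ∀ A ∈ M, ∀ k ∈ box d n,
      ∀ i ∈ Finset.range (n + 1), ∀ x, |iteratedDeriv i (conjShift A k θ').1 x
        - iteratedDeriv i (conjShift A k θ).1 x| ≤ (1 / 2) ^ n := by
    refine (Filter.eventually_all_finite hMfin).2 fun A _ =>
      (Filter.eventually_all_finset _).2 fun k _ => (Filter.eventually_all_finset _).2 fun i _ => ?_
    exact (continuous_pair k).continuousAt.eventually
      (eventually_conj_shift_close A i (pair k θ) hpow)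
  have hfree' : ∀ᶠ θ' in 𝓝 θ, ∀ k ∈ box d n, k ≠ 0 → ∀ m : ℤ, pair k θ' ≠ m := by
    refine (Filter.eventually_all_finset _).2 fun k hkn => ?_
    by_cases hk : k = 0
    · simp [hk]
    · filter_upwards [(isOpen_pair_ne_int k).mem_nhds (hfree k hkn hk)] with θ hθ _ using hθ
  obtain ⟨ρ, hρ, hball⟩ := Metric.nhds_basis_closedBall.eventually_iff.1 (hclose.and hfree')
  have hmin : ∀ θ' ∈ Metric.closedBall θ (min ρ (S.r / 2)), θ' ∈ Metric.closedBall θ ρ :=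
    Metric.closedBall_subset_closedBall (min_le_left _ _)
  have hε := S.ε_pos
  refine ⟨{ maps := M, finite_maps := hMfin, q := q, p := p, h := h, r := min ρ (S.r / 2),
            r_pos := lt_min hρ (half_pos S.r_pos),
            -- The factors 1/4 absorb two perturbations, each changing a distance by up to 2ε.
            ε := min (S.ε / 2) (min (1 / (4 * q) / 4) (δ' / 2 / 4)),
            ε_pos := by positivity }, ?_⟩
  exact
  { q_pos := two_pos.trans_le hqtwo
    coprime := hcop
    θ_mem := hθ
    r_le := min_le_right _ _
    ε_le := min_le_left _ _
    commute := hcomm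
    mem_maps := fun A hA => Or.inl hA
    mul_mem_maps := fun A hA => Or.inr ⟨A, hA, rfl⟩
    near := fun A hA x => hq1 A hA _ _ (hh x)
    near_inv := fun x => (hhinv x).trans hq2
    free := fun θ' hθ' => (hball (hmin θ' hθ')).2
    close := fun θ' hθ' => (hball (hmin θ' hθ')).1
    distorts := by
      refine ⟨η, 1 / (4 * q), δ' / 2, hηpos, min_le_right _ _, ?_, ?_, fun A hA x y hc =>
        (min_le_left _ _).trans (hA1 A hA x y hc), fun A hA x y hd => hA2 A hA x y (by linarith),
        x, y, hxy, ?_, hhhxy⟩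
      · have := (min_le_right (S.ε / 2) _).trans (min_le_left (1 / (4 * (q : ℝ)) / 4) (δ' / 2 / 4))
        linarith
      · have := (min_le_right (S.ε / 2) _).trans (min_le_right (1 / (4 * (q : ℝ)) / 4) (δ' / 2 / 4))
        linarith
      · refine le_of_eq_of_le ?_ hhxy
        field_simp
        norm_num }

/-! ### Runs of the construction and their limits -/

/-- A uniform limit of homeomorphisms need not be injective; convergence of the inverses as well
supplies an inverse of the limit. -/
theorem exists_unit_limit {u : ℕ → CircleDeg1Liftˣ} {C C' : ℝ}
    (h : ∀ n x, |u (n + 1) x - u n x| ≤ C / 2 / 2 ^ n)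
    (h' : ∀ n x, |(u (n + 1))⁻¹ x - (u n)⁻¹ x| ≤ C' / 2 / 2 ^ n) :
    ∃ U : CircleDeg1Liftˣ, TendstoUniformly (fun n => (u n : ℝ → ℝ)) U atTop ∧
      TendstoUniformly (fun n => (((u n)⁻¹ : CircleDeg1Liftˣ) : ℝ → ℝ))
        ((U⁻¹ : CircleDeg1Liftˣ) : ℝ → ℝ) atTop := by
  have key : ∀ {v : ℕ → CircleDeg1Liftˣ} {C : ℝ}, (∀ n x, |v (n + 1) x - v n x| ≤ C / 2 / 2 ^ n) →
      ∃ V : CircleDeg1Lift, TendstoUniformly (fun n => (v n : ℝ → ℝ)) V atTop := by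
    intro v C hv
    have hv' : ∀ x n, dist (v n x) (v (n + 1) x) ≤ C / 2 / 2 ^ n := fun x n => by
      rw [dist_comm]; exact hv n x
    choose V hV using fun x => cauchySeq_tendsto_of_complete
      (cauchySeq_of_le_geometric_two (hv' x))
    refine ⟨⟨⟨V, fun x y hxy => ?_⟩, fun x => ?_⟩, ?_⟩
    · exact le_of_tendsto_of_tendsto' (hV x) (hV y) fun n => CircleDeg1Lift.monotone _ hxy
    · refine tendsto_nhds_unique (hV (x + 1)) ?_
      simp only [CircleDeg1Lift.map_add_one]
      exact (hV x).add_const 1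
    · rw [Metric.tendstoUniformly_iff]
      intro ε hε
      have h0 : Tendsto (fun n : ℕ => C / 2 ^ n) atTop (𝓝 0) :=
        tendsto_const_nhds.div_atTop (tendsto_pow_atTop_atTop_of_one_lt one_lt_two)
      filter_upwards [h0.eventually (gt_mem_nhds hε)] with n hn x
      rw [dist_comm]
      exact (dist_le_of_le_geometric_two_of_tendsto (hv' x) (hV x) n).trans_lt hn
  obtain ⟨U, hU⟩ := key h
  obtain ⟨V, hV⟩ := key (v := fun n => (u n)⁻¹) h'
  have hUc : Continuous U :=
    hU.continuous (Frequently.of_forall fun n => continuous_lift_unit (u n))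
  have hVc : Continuous V :=
    hV.continuous (Frequently.of_forall fun n => continuous_lift_unit (u n)⁻¹)
  refine ⟨⟨U, V, CircleDeg1Lift.ext fun x => ?_, CircleDeg1Lift.ext fun x => ?_⟩, hU, hV⟩
  · refine tendsto_nhds_unique (hU.tendsto_comp hUc.continuousAt (hV.tendsto_at x)) ?_
    simp only [CircleDeg1Lift.units_apply_inv_apply]
    exact tendsto_const_nhds
  · refine tendsto_nhds_unique (hV.tendsto_comp hVc.continuousAt (hU.tendsto_at x)) ?_
    simp only [CircleDeg1Lift.units_inv_apply_apply]
    exact tendsto_const_nhds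

/-- The commuting map used at step `n` for the symbol `s`. -/
def stepMap (S : ℕ → Stage d) (n : ℕ) (s : Bool) : smoothUnits := cond s (S (n + 1)).h 1

/-- The conjugating maps of the sequence `a`. -/
def conjMap (S : ℕ → Stage d) (a : ℕ → Bool) : ℕ → smoothUnits
  | 0 => 1
  | n + 1 => conjMap S a n * stepMap S n (a n)

/-- The stages form a run of the construction, started from the identity. -/
structure IsRun (S : ℕ → Stage d) : Prop where
  one_mem : 1 ∈ (S 0).maps
  succ : ∀ n, (S n).Succ n (S (n + 1))

theorem exists_isRun (d : ℕ) : ∃ S : ℕ → Stage d, IsRun S := by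
  choose f hf using fun (n : ℕ) (S : Stage d) => S.exists_succ n
  -- Only the singleton {id} of maps matters here; the other values are arbitrary.
  let S₀ : Stage d := ⟨{1}, Set.finite_singleton 1, 1, 0, 1, 1, one_pos, 1, one_pos⟩
  exact ⟨fun n => Nat.rec (motive := fun _ => Stage d) S₀ f n, Set.mem_singleton _, fun n => hf n _⟩

namespace IsRun

variable {S : ℕ → Stage d} (hS : IsRun S) (a : ℕ → Bool)
include hS

theorem conjMap_mem (n : ℕ) : conjMap S a n ∈ (S n).maps := by
  induction n with
  | zero => exact hS.one_mem
  | succ n ih =>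
    rw [conjMap, stepMap]
    cases a n
    · rw [cond_false, mul_one]
      exact (hS.succ n).mem_maps _ ih
    · exact (hS.succ n).mul_mem_maps _ ih

theorem commute_stepMap (n : ℕ) (s : Bool) : Commute (stepMap S n s) (shift (1 / (S (n + 1)).q)) := by
  cases s
  · exact Commute.one_left _
  · exact (hS.succ n).commute

theorem conjMap_near (n : ℕ) (x : ℝ) :
    |(conjMap S a (n + 1)).1 x - (conjMap S a n).1 x| ≤ (1 / 2) ^ n := by
  rw [conjMap, stepMap]
  cases a n
  · simp
  · exact (hS.succ n).near _ (hS.conjMap_mem a n) x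

theorem conjMap_inv_near (n : ℕ) (x : ℝ) :
    |((conjMap S a (n + 1))⁻¹).1 x - ((conjMap S a n)⁻¹).1 x| ≤ (S n).ε / 2 := by
  rw [conjMap, stepMap, mul_inv_rev]
  cases a n
  · simpa using (half_pos (S n).ε_pos).le
  · exact (hS.succ n).near_inv _

theorem ε_le (n m : ℕ) : (S (m + n)).ε ≤ (S n).ε / 2 ^ m := by
  induction m with
  | zero => simp
  | succ m ih =>
    rw [Nat.succ_add, pow_succ, ← div_div]
    exact (hS.succ (m + n)).ε_le.trans (by gcongr)

theorem r_le (n : ℕ) : (S n).r ≤ (S 0).r / 2 ^ n := by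
  induction n with
  | zero => simp
  | succ n ih =>
    rw [pow_succ, ← div_div]
    exact (hS.succ n).r_le.trans (by gcongr)

/-- The centre moves by at most r/2 and the new radius is at most r/2; so α lies in every ball and
inherits the conditions imposed there. -/
theorem closedBall_antitone :
    Antitone fun n => Metric.closedBall (S n).θ (S n).r :=
  antitone_nat_of_succ_le fun n => Metric.closedBall_subset_closedBall' (by
    have h1 := Metric.mem_closedBall.1 (hS.succ n).θ_mem
    have h2 := (hS.succ n).r_le
    linarith)

theorem exists_angle : ∃ α : Fin d → ℝ, Tendsto (fun n => (S n).θ) atTop (𝓝 α) ∧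
    ∀ n, α ∈ Metric.closedBall (S n).θ (S n).r := by
  have h : ∀ n, dist (S n).θ (S (n + 1)).θ ≤ (S 0).r / 2 / 2 ^ n := fun n => by
    rw [dist_comm, div_right_comm]
    exact (Metric.mem_closedBall.1 (hS.succ n).θ_mem).trans (by have := hS.r_le n; gcongr)
  obtain ⟨α, hα⟩ := cauchySeq_tendsto_of_complete (cauchySeq_of_le_geometric_two h)
  refine ⟨α, hα, fun n => Metric.isClosed_closedBall.mem_of_tendsto hα ?_⟩
  filter_upwards [eventually_ge_atTop n] with m hm
  exact hS.closedBall_antitone hm (Metric.mem_closedBall_self (S m).r_pos.le)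

/-- In H_{n+1}⁻¹ = h⁻¹ H_n⁻¹ the new factor acts last, so the increment is a displacement of h⁻¹, at
most ε_n/2. As ε halves at each step, the tail sums to at most ε_n. -/
theorem exists_limit : ∃ U : CircleDeg1Liftˣ,
    TendstoUniformly (fun n => ((conjMap S a n).1 : ℝ → ℝ)) U atTop ∧
    (∀ x, Tendsto (fun n => ((conjMap S a n)⁻¹).1 x) atTop (𝓝 (U⁻¹ x))) ∧
    ∀ n x, |U⁻¹ x - ((conjMap S a n)⁻¹).1 x| ≤ (S n).ε := by
  obtain ⟨U, hU, hV⟩ := exists_unit_limit (u := fun n => (conjMap S a n).1) (C := 2)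
    (C' := (S 0).ε) (fun n x => (hS.conjMap_near a n x).trans_eq (by simp))
    (fun n x => (hS.conjMap_inv_near a n x).trans (by
      have := hS.ε_le 0 n
      rw [add_zero] at this
      rw [div_right_comm]
      gcongr))
  refine ⟨U, hU, fun x => hV.tendsto_at x, fun n x => ?_⟩
  have h : ∀ m, dist (((conjMap S a (m + n))⁻¹).1 x) (((conjMap S a (m + 1 + n))⁻¹).1 x)
      ≤ (S n).ε / 2 / 2 ^ m := fun m => by
    rw [dist_comm, add_right_comm, div_right_comm]
    exact (hS.conjMap_inv_near a (m + n) x).trans (by have := hS.ε_le n m; gcongr)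
  have := dist_le_of_le_geometric_two_of_tendsto₀ h
    ((tendsto_add_atTop_iff_nat n).2 (hV.tendsto_at x))
  rwa [zero_add, dist_comm] at this

/-- The AbC cancellation: `pair k θ` is an integer multiple of 1/q, so the new factor commutes with
the rotation. -/
theorem conjShift_succ (n : ℕ) (k : Fin d → ℤ) :
    conjShift (conjMap S a (n + 1)) k (S (n + 1)).θ = conjShift (conjMap S a n) k (S (n + 1)).θ := by
  have hp : pair k (S (n + 1)).θ = (∑ i, k i * (S (n + 1)).p i : ℤ) * (1 / (S (n + 1)).q) := by
    rw [pair, Int.cast_sum, Finset.sum_mul]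
    refine Finset.sum_congr rfl fun i _ => ?_
    rw [Stage.θ]
    push_cast
    ring
  have hc : Commute (stepMap S n (a n)) (shift (pair k (S (n + 1)).θ)) := by
    rw [hp, ← shift_zpow]
    exact (hS.commute_stepMap n (a n)).zpow_right _
  rw [conjShift, conjShift, conjMap, mul_inv_rev, mul_assoc (conjMap S a n), hc.eq]
  group

theorem conjShift_close {n : ℕ} {k : Fin d → ℤ} (hk : k ∈ box d n) {i : ℕ} (hi : i ≤ n) (x : ℝ) :
    |iteratedDeriv i (conjShift (conjMap S a (n + 1)) k (S (n + 1 + 1)).θ).1 x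
      - iteratedDeriv i (conjShift (conjMap S a n) k (S (n + 1)).θ).1 x| ≤ (1 / 2) ^ n := by
  rw [← hS.conjShift_succ a n]
  exact (hS.succ n).close _ (hS.closedBall_antitone (Nat.le_succ _)
    (Metric.mem_closedBall_self (S (n + 1 + 1)).r_pos.le)) _ (hS.conjMap_mem a (n + 1)) k hk i
    (Finset.mem_range.2 (Nat.lt_succ_of_le hi)) x

end IsRun

theorem box_mono {n m : ℕ} (h : n ≤ m) : box d n ⊆ box d m :=
  Finset.Icc_subset_Icc (fun _ => neg_le_neg (Int.ofNat_le.2 h)) (fun _ => Int.ofNat_le.2 h)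

/-! ### The limit action and its AbC data -/

/-- The action and the conjugating map `U` to rotations with angles `α` that a run of the
construction yields for the sequence `a`. -/
structure IsLimit (S : ℕ → Stage d) (α : Fin d → ℝ) (a : ℕ → Bool) (U : CircleDeg1Liftˣ)
    (φ : FreeAction d) : Prop where
  toHomeo_act : ∀ k, (φ.act k).toHomeo = circleHomeo (U * (shift (pair k α)).1 * U⁻¹)
  dist_act : ∀ n, ∀ k ∈ box d n,
    dist (φ.act k) (toDiffeo (conjShift (conjMap S a n) k (S (n + 1)).θ)) ≤ 6 * (1 / 2) ^ n
  inv_near : ∀ n x, |U⁻¹ x - ((conjMap S a n)⁻¹).1 x| ≤ (S n).ε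
  tendsto : ∀ x, Tendsto (fun n => (conjMap S a n).1 x) atTop (𝓝 (U x))

theorem IsRun.exists_isLimit {S : ℕ → Stage d} (hS : IsRun S) {α : Fin d → ℝ}
    (hα : Tendsto (fun n => (S n).θ) atTop (𝓝 α)) (hfree : ∀ k, k ≠ 0 → ∀ m : ℤ, pair k α ≠ m)
    (a : ℕ → Bool) : ∃ U φ, IsLimit S α a U φ := by
  obtain ⟨U, hU, hV, hnear⟩ := hS.exists_limit a
  have hlim : ∀ k x, Tendsto (fun n => (conjShift (conjMap S a n) k (S (n + 1)).θ).1 x) atTop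
      (𝓝 ((U * (shift (pair k α)).1 * U⁻¹) x)) := by
    intro k x
    have h1 := ((continuous_pair k).tendsto α).comp ((tendsto_add_atTop_iff_nat 1).2 hα)
    have h2 := hU.tendsto_comp (continuous_lift_unit U).continuousAt ((hV x).add h1)
    have e : (U * (shift (pair k α)).1 * U⁻¹) x = U (U⁻¹ x + pair k α) :=
      congrArg U (shift_apply _ _)
    rw [e]
    refine h2.congr fun n => ?_
    exact congrArg (conjMap S a n).1 (shift_apply _ _).symm
  -- The estimates for k start once k has entered the box, which is the threshold of the smoothness
  -- criterion.
  have hsm : ∀ n, ∀ k ∈ box d n, _ := fun n k hk =>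
    contDiff_of_iteratedDeriv_geometric (fun m => (conjShift (conjMap S a m) k (S (m + 1)).θ).2.1)
      (hlim k) fun i m (hm : n ≤ m) hi x => hS.conjShift_close a (box_mono hm hk) hi x
  have hsmooth : ∀ k, ContDiff ℝ ∞ (U * (shift (pair k α)).1 * U⁻¹ : CircleDeg1Liftˣ) := fun k => by
    obtain ⟨N, hN⟩ := exists_mem_box k
    exact (hsm N k (hN N le_rfl)).1
  have hinv : ∀ k, (U * (shift (pair k α)).1 * U⁻¹)⁻¹ = U * (shift (pair (-k) α)).1 * U⁻¹ := by
    intro k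
    rw [pair_neg, shift_neg, InvMemClass.coe_inv]
    group
  -- U need not be smooth; the inverse of the element for k is smooth because it is the element for
  -- -k.
  let L : (Fin d → ℤ) → smoothUnits := fun k => ⟨U * (shift (pair k α)).1 * U⁻¹, hsmooth k, by
    rw [hinv]; exact hsmooth (-k)⟩
  have hL : ∀ k l, L (k + l) = L k * L l := fun k l => Subtype.ext (by
    change U * (shift (pair (k + l) α)).1 * U⁻¹ =
      (U * (shift (pair k α)).1 * U⁻¹) * (U * (shift (pair l α)).1 * U⁻¹)
    rw [pair_add, shift_add, Subgroup.coe_mul]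
    group)
  have hL0 : L 0 = 1 := by simpa using hL 0 0
  have hLinv : ∀ k, (L k)⁻¹ = L (-k) := fun k => Subtype.ext (hinv k)
  refine ⟨U, ⟨⟨⟨fun k => toDiffeo (L k.toAdd), ?_⟩, ?_⟩, ?_⟩, ?_, ?_, hnear, fun x => hU.tendsto_at x⟩
  · change toDiffeo (L 0) = 1
    rw [hL0, map_one]
  · intro k l
    change toDiffeo (L (k.toAdd + l.toAdd)) = _
    rw [hL, map_mul]
  · intro k hk x hx
    have hx' : circleHomeo (U * (shift (pair k α)).1 * U⁻¹) x = x := hx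
    rw [map_mul, map_mul, map_inv] at hx'
    have h2 : circleHomeo (shift (pair k α)).1 ((circleHomeo U).symm x) = (circleHomeo U).symm x := by
      rw [Homeomorph.eq_symm_apply]
      exact hx'
    rw [circleHomeo_shift, add_eq_left, AddCircle.coe_eq_zero_iff] at h2
    obtain ⟨m, hm⟩ := h2
    exact hfree k hk m (by simpa using hm.symm)
  · exact fun _ => rfl
  · intro n k hk
    -- With ε = 2 · 2^{-n} the bound is 4 · 2^{-n} + 2 · 2^{-n}, the source of the constant 6.
    have h := dist_toDiffeo_le (u := L k) (v := conjShift (conjMap S a n) k (S (n + 1)).θ) (n := n)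
      (ε := 2 * (1 / 2) ^ n) (by positivity) (fun i hi x => (hsm n k hk).2 i n le_rfl hi x)
      (fun i hi x => by
        have e : (conjShift (conjMap S a n) k (S (n + 1)).θ)⁻¹
            = conjShift (conjMap S a n) (-k) (S (n + 1)).θ := by
          rw [conjShift, conjShift, pair_neg, shift_neg]
          group
        rw [hLinv, e]
        exact (hsm n (-k) (neg_mem_box hk)).2 i n le_rfl hi x)
    refine le_of_le_of_eq h ?_
    ring

/-- Clearing denominators, a rational relation becomes an integral one, which makes some `pair k α`
an integer. -/
theorem linearIndependent_of_pair_ne_int {α : Fin d → ℝ}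
    (h : ∀ k, k ≠ 0 → ∀ m : ℤ, pair k α ≠ m) :
    LinearIndependent ℚ (Fin.cons 1 α : Fin (d + 1) → ℝ) := by
  rw [← LinearIndependent.iff_fractionRing ℤ ℚ, Fintype.linearIndependent_iff]
  intro g hg
  rw [Fin.sum_univ_succ] at hg
  simp only [Fin.cons_zero, Fin.cons_succ, zsmul_eq_mul, mul_one] at hg
  have htail : (fun i => g (Fin.succ i)) = 0 := by
    by_contra hne
    refine h _ hne (-g 0) ?_
    rw [pair]
    push_cast
    linarith
  have hg0 : g 0 = 0 := by
    have : ∀ i : Fin d, g i.succ = 0 := fun i => congrFun htail i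
    simpa [this] using hg
  exact Fin.cases hg0 fun i => congrFun htail i

theorem IsRun.pair_ne_int {S : ℕ → Stage d} (hS : IsRun S) {α : Fin d → ℝ}
    (hα : ∀ n, α ∈ Metric.closedBall (S n).θ (S n).r) (k : Fin d → ℤ) (hk : k ≠ 0) (m : ℤ) :
    pair k α ≠ m := by
  obtain ⟨N, hN⟩ := exists_mem_box k
  exact (hS.succ N).free α (hα (N + 1)) k (hN N le_rfl) hk m

/-- The AbC data of a run of the construction. -/
def IsRun.data {S : ℕ → Stage d} (hS : IsRun S) : AbCData d where
  -- Shifted by one: H_n is paired with the angles of stage n + 1, whose denominator also governs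
  -- the next factor.
  q n := (S (n + 1)).q
  q_pos n := (hS.succ n).q_pos
  p i n := (S (n + 1)).p i
  coprime i n := (hS.succ n).coprime i
  h n s := toDiffeo (stepMap S n s)
  commute n s := by
    rw [← toDiffeo_shift, ← map_mul, ← map_mul, (hS.commute_stepMap n s).eq]

theorem IsRun.data_conj {S : ℕ → Stage d} (hS : IsRun S) (a : ℕ → Bool) (n : ℕ) :
    hS.data.conj a n = toDiffeo (conjMap S a n) := by
  induction n with
  | zero => exact (map_one _).symm
  | succ n ih =>
    rw [conjMap, map_mul, ← ih]
    rfl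

theorem IsRun.data_approx {S : ℕ → Stage d} (hS : IsRun S) (a : ℕ → Bool) (i : Fin d) (n : ℕ) :
    hS.data.approx a i n
      = toDiffeo (conjShift (conjMap S a n) (Pi.single i 1) (S (n + 1)).θ) := by
  rw [AbCData.approx, hS.data_conj, conjShift, map_mul, map_mul, map_inv, toDiffeo_shift, pair_single]
  rfl

theorem isLocallyConstant_conjMap (S : ℕ → Stage d) (n : ℕ) :
    IsLocallyConstant fun a : ℕ → Bool => conjMap S a n := by
  induction n with
  | zero => exact IsLocallyConstant.const _
  | succ n ih =>
    exact ih.comp₂ ((IsLocallyConstant.iff_continuous _).2 (continuous_apply n))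
      fun A s => A * stepMap S n s

theorem tendsto_six_mul_pow : Tendsto (fun n : ℕ => 6 * (1 / 2 : ℝ) ^ n) atTop (𝓝 0) := by
  simpa using (tendsto_pow_atTop_nhds_zero_of_lt_one (r := (1 / 2 : ℝ)) (by norm_num)
    (by norm_num)).const_mul 6

theorem Diffeo.toHomeo_injective : Function.Injective Diffeo.toHomeo := Subtype.val_injective

/-! ### Conjugacies between limit actions -/

/-- A homeomorphism commuting with an irrational rotation is a rotation. -/
theorem eq_add_of_commute_rotation {g : S1 → S1} (hg : Continuous g) {α : ℝ}
    (hα : Irrational α) (h : ∀ x, g (x + (α : S1)) = g x + (α : S1)) (x : S1) : g x = x + g 0 := by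
  have hz : ∀ m : ℤ, g (m • (α : S1)) = m • (α : S1) + g 0 := by
    intro m
    induction m using Int.induction_on with
    | zero => simp
    | succ n ih => rw [add_zsmul, one_zsmul, h, ih]; abel
    | pred n ih =>
      have := h ((-(n : ℤ) - 1) • (α : S1))
      rw [sub_zsmul, one_zsmul, neg_add_cancel_right, ih] at this
      rw [sub_zsmul, one_zsmul, eq_sub_of_add_eq this.symm]
      abel
  have hd : DenseRange fun m : ℤ => m • (α : S1) := by
    rw [AddCircle.denseRange_zsmul_coe_iff, div_one]
    exact hα
  exact congrFun (hd.equalizer hg (continuous_id.add continuous_const) (funext hz)) x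

namespace IsLimit

variable {S : ℕ → Stage d} {α : Fin d → ℝ} {a b : ℕ → Bool} {U U' : CircleDeg1Liftˣ}
  {φ ψ : FreeAction d}

theorem tendsto_approx (hS : IsRun S) (h : IsLimit S α a U φ) (i : Fin d) :
    Tendsto (hS.data.approx a i) atTop (𝓝 (φ.generator i)) := by
  rw [tendsto_iff_dist_tendsto_zero]
  obtain ⟨N, hN⟩ := exists_mem_box (Pi.single i 1 : Fin d → ℤ)
  refine squeeze_zero' (Eventually.of_forall fun _ => dist_nonneg) ?_ tendsto_six_mul_pow
  filter_upwards [eventually_ge_atTop N] with n hn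
  rw [hS.data_approx, dist_comm]
  exact h.dist_act n _ (hN n hn)

theorem hasRotationNumber (h : IsLimit S α a U φ) (i : Fin d) :
    HasRotationNumber (φ.generator i) (α i : S1) := by
  refine ⟨(U * (shift (pair (Pi.single i 1) α)).1 * U⁻¹ : CircleDeg1Liftˣ), ?_, ?_⟩
  · rw [FreeAction.generator, h.toHomeo_act]
    exact isLift_circleHomeo _
  · rw [Units.val_mul, Units.val_mul, CircleDeg1Lift.translationNumber_conj_eq, pair_single]
    exact congrArg _ (CircleDeg1Lift.translationNumber_translate (α i))

/-- Equal tails cancel: H_{b,n} = B H_{a,n} for n ≥ N with the fixed smooth B = H_{b,N} H_{a,N}⁻¹,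
and this passes to the limit. -/
theorem smoothConj (ha : IsLimit S α a U φ) (hb : IsLimit S α b U' ψ)
    (hab : ∃ N, ∀ n, N ≤ n → a n = b n) : φ.SmoothConj ψ := by
  obtain ⟨N, hN⟩ := hab
  set B := conjMap S b N * (conjMap S a N)⁻¹ with hB
  have hmap : ∀ n, N ≤ n → conjMap S b n = B * conjMap S a n := by
    intro n hn
    induction n, hn using Nat.le_induction with
    | base => rw [hB]; group
    | succ n hn ih => rw [conjMap, conjMap, ih, hN n hn, mul_assoc]
  have hU : U' = B.1 * U := by
    refine Units.ext (CircleDeg1Lift.ext fun x => ?_)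
    refine tendsto_nhds_unique (hb.tendsto x) ?_
    refine (((continuous_lift_unit B.1).tendsto _).comp (ha.tendsto x)).congr' ?_
    filter_upwards [eventually_ge_atTop N] with n hn
    rw [hmap n hn]
    rfl
  refine ⟨toDiffeo B, fun k => Diffeo.toHomeo_injective ?_⟩
  rw [map_mul, map_mul, map_inv, ha.toHomeo_act, hb.toHomeo_act, toHomeo_toDiffeo, hU, ← map_mul,
    ← map_inv, ← map_mul]
  simp only [mul_inv_rev, mul_assoc]

/-- The map U'⁻¹ h U commutes with rotation by the irrational first angle, hence is itself a
rotation. -/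
theorem exists_eq_add (hfree : ∀ k, k ≠ 0 → ∀ m : ℤ, pair k α ≠ m) (hd : 1 ≤ d)
    (ha : IsLimit S α a U φ) (hb : IsLimit S α b U' ψ) {h : S1 ≃ₜ S1}
    (hconj : ∀ k, (ψ.act k).toHomeo = h * (φ.act k).toHomeo * h⁻¹) :
    ∃ t : S1, ∀ x, h (circleHomeo U x) = circleHomeo U' (x + t) := by
  let i : Fin d := ⟨0, hd⟩
  have hirr : Irrational (α i) := by
    rintro ⟨r, hr⟩
    refine hfree (Pi.single i r.den) (by simp) r.num ?_
    simp only [pair, Pi.single_apply, Int.cast_ite, ite_mul, Int.cast_zero, zero_mul,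
      Finset.sum_ite_eq', Finset.mem_univ, if_true]
    rw [← hr]
    exact_mod_cast r.den_mul_eq_num
  set g : S1 ≃ₜ S1 := (circleHomeo U')⁻¹ * h * circleHomeo U with hg
  have hcomm : g * circleHomeo (shift (α i)).1 = circleHomeo (shift (α i)).1 * g := by
    have := hconj (Pi.single i 1)
    rw [ha.toHomeo_act, hb.toHomeo_act, pair_single] at this
    simp only [map_mul, map_inv] at this
    have e : g * circleHomeo (shift (α i)).1 = (circleHomeo U')⁻¹ *
        (h * (circleHomeo U * circleHomeo (shift (α i)).1 * (circleHomeo U)⁻¹) * h⁻¹)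
          * h * circleHomeo U := by
      rw [hg]; group
    rw [e, ← this, hg]
    group
  have hrot := eq_add_of_commute_rotation g.continuous hirr fun x => by
    have := DFunLike.congr_fun hcomm x
    rw [← circleHomeo_shift, ← circleHomeo_shift]
    exact this
  refine ⟨g 0, fun x => ?_⟩
  rw [← hrot x]
  exact ((circleHomeo U').apply_symm_apply _).symm

theorem dist_conjMap_inv_le (ha : IsLimit S α a U φ) (n : ℕ) (z : S1) :
    dist ((circleHomeo (conjMap S a n).1).symm (circleHomeo U z)) z ≤ (S n).ε := by
  obtain ⟨y, rfl⟩ := (circleHomeo U).symm.surjective z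
  rw [Homeomorph.apply_symm_apply]
  induction y using QuotientAddGroup.induction_on with
  | H y =>
    refine (dist_coe_le _ _).trans ?_
    rw [abs_sub_comm]
    exact ha.inv_near n y

/-- Write U = H_{a,n} ∘ (step map) ∘ W and U' = H_{b,n} ∘ (step map) ∘ W' with W, W' within ε of the
identity. One step map is h, the other the identity; the points are placed exactly for h, and the
side with the identity needs only their distance. -/
theorem exists_distorted (hS : IsRun S) (ha : IsLimit S α a U φ) (hb : IsLimit S α b U' ψ)
    {n : ℕ} (hab : a n ≠ b n) (t : S1) : ∃ η : ℝ, 0 < η ∧ η ≤ 1 ∧ ∃ x y : S1,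
      η ≤ dist (circleHomeo U' (x + t)) (circleHomeo U' (y + t)) ∧
      dist (circleHomeo U x) (circleHomeo U y) ≤ (η / (n + 2)) ^ (n + 1) := by
  obtain ⟨η, c, δ, hη, hη1, hεc, hεδ, hfar, hnear, x₀, y₀, h1, h2, h3⟩ := (hS.succ n).distorts
  refine ⟨η, hη, hη1, ?_⟩
  set ε := (S (n + 1)).ε
  have hε : 0 < ε := (S (n + 1)).ε_pos
  set h := circleHomeo (S (n + 1)).h.1
  let W : S1 ≃ₜ S1 := (circleHomeo (conjMap S a (n + 1)).1)⁻¹ * circleHomeo U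
  let W' : S1 ≃ₜ S1 := (circleHomeo (conjMap S b (n + 1)).1)⁻¹ * circleHomeo U'
  have hW : ∀ z, dist (W z) z ≤ ε := ha.dist_conjMap_inv_le (n + 1)
  have hW' : ∀ z, dist (W' z) z ≤ ε := hb.dist_conjMap_inv_le (n + 1)
  have hU : circleHomeo U = circleHomeo (conjMap S a n).1 * circleHomeo (stepMap S n (a n)).1 * W := by
    rw [← map_mul, ← Subgroup.coe_mul]
    exact (mul_inv_cancel_left _ _).symm
  have hU' : circleHomeo U'
      = circleHomeo (conjMap S b n).1 * circleHomeo (stepMap S n (b n)).1 * W' := by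
    rw [← map_mul, ← Subgroup.coe_mul]
    exact (mul_inv_cancel_left _ _).symm
  have hA := hS.conjMap_mem a n
  have hB := hS.conjMap_mem b n
  have hWW : ∀ x y, dist x y - 2 * ε ≤ dist (W x) (W y) ∧ dist (W x) (W y) ≤ dist x y + 2 * ε := by
    intro x y
    have e1 := dist_triangle4 x (W x) (W y) y
    have e2 := dist_triangle4 (W x) x y (W y)
    rw [dist_comm x (W x)] at e1
    rw [dist_comm y (W y)] at e2
    constructor <;> linarith [hW x, hW y]
  have hWW' : ∀ x y, dist x y - 2 * ε ≤ dist (W' x) (W' y) ∧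
      dist (W' x) (W' y) ≤ dist x y + 2 * ε := by
    intro x y
    have e1 := dist_triangle4 x (W' x) (W' y) y
    have e2 := dist_triangle4 (W' x) x y (W' y)
    rw [dist_comm x (W' x)] at e1
    rw [dist_comm y (W' y)] at e2
    constructor <;> linarith [hW' x, hW' y]
  have hδ : 0 ≤ δ := by linarith
  have hstep_true : circleHomeo (stepMap S n true).1 = h := rfl
  have hstep_false : circleHomeo (stepMap S n false).1 = 1 := map_one circleHomeo
  rcases ha' : a n <;> rcases hb' : b n <;> simp only [ha', hb', ne_eq, not_true_eq_false] at hab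
  · rw [ha', hstep_false, mul_one] at hU
    rw [hb', hstep_true] at hU'
    -- Here U' contains h: the pair starts close and h separates it.
    refine ⟨W'.symm x₀ - t, W'.symm y₀ - t, ?_, ?_⟩
    · rw [sub_add_cancel, sub_add_cancel, hU']
      refine hfar _ hB _ _ ?_
      change c ≤ dist (h (W' (W'.symm x₀))) (h (W' (W'.symm y₀)))
      rw [Homeomorph.apply_symm_apply, Homeomorph.apply_symm_apply]
      linarith
    · rw [hU]
      refine hnear _ hA _ _ ((hWW _ _).2.trans ?_)
      rw [dist_sub_right]
      have := (hWW' (W'.symm x₀) (W'.symm y₀)).1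
      rw [Homeomorph.apply_symm_apply, Homeomorph.apply_symm_apply] at this
      linarith
  · rw [ha', hstep_true] at hU
    rw [hb', hstep_false, mul_one] at hU'
    -- Here U contains h: the pair starts far apart, at the images under h, and h brings it
    -- together.
    refine ⟨W.symm (h x₀), W.symm (h y₀), ?_, ?_⟩
    · rw [hU']
      refine hfar _ hB _ _ (le_trans ?_ (hWW' _ _).1)
      rw [dist_add_right]
      have := (hWW (W.symm (h x₀)) (W.symm (h y₀))).2
      rw [Homeomorph.apply_symm_apply, Homeomorph.apply_symm_apply] at this
      linarith
    · rw [hU]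
      refine hnear _ hA _ _ ?_
      change dist (h (W (W.symm (h x₀)))) (h (W (W.symm (h y₀)))) ≤ 2 * δ
      rw [Homeomorph.apply_symm_apply, Homeomorph.apply_symm_apply]
      linarith

/-- Take n with (n + 1)β ≥ 1 and C < n + 2: the Hölder bound then gives η ≤ C η/(n + 2) < η. -/
theorem not_holderConj (hS : IsRun S) (hfree : ∀ k, k ≠ 0 → ∀ m : ℤ, pair k α ≠ m) (hd : 1 ≤ d)
    (ha : IsLimit S α a U φ) (hb : IsLimit S α b U' ψ) (hab : {n | a n ≠ b n}.Infinite) :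
    ¬ φ.HolderConj ψ := by
  rintro ⟨h, -, ⟨β, C, hβ, -, hC⟩, hconj⟩
  obtain ⟨t, ht⟩ := ha.exists_eq_add hfree hd hb hconj
  obtain ⟨M, hM⟩ := exists_nat_gt (max (C : ℝ) (1 / β))
  obtain ⟨n, hn, hMn⟩ := hab.exists_gt M
  obtain ⟨η, hη, hη1, x, y, hxy, hxy'⟩ := ha.exists_distorted hS hb hn t
  have hβ' : (0 : ℝ) < β := hβ
  have hMn' : (M : ℝ) < n := Nat.cast_lt.2 hMn
  have hCn : (C : ℝ) < n + 2 := by linarith [le_max_left (C : ℝ) (1 / β)]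
  have hβn : 1 ≤ ((n + 1 : ℕ) : ℝ) * β := by
    have : 1 / (β : ℝ) ≤ (n + 1 : ℕ) := by
      push_cast
      linarith [le_max_right (C : ℝ) (1 / β)]
    rwa [div_le_iff₀ hβ'] at this
  have hn0 : (0 : ℝ) < n + 2 := by positivity
  have hle1 : η / (n + 2) ≤ 1 := by
    rw [div_le_one hn0]
    linarith [(Nat.cast_nonneg n : (0 : ℝ) ≤ n)]
  have key : η ≤ C * (η / (n + 2)) := by
    rw [← ht, ← ht] at hxy
    refine hxy.trans ((hC.dist_le _ _).trans ?_)
    refine mul_le_mul_of_nonneg_left ?_ C.coe_nonneg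
    refine (Real.rpow_le_rpow dist_nonneg hxy' hβ'.le).trans ?_
    rw [← Real.rpow_natCast, ← Real.rpow_mul (by positivity)]
    exact (Real.rpow_le_rpow_of_exponent_ge (by positivity) hle1 hβn).trans_eq (Real.rpow_one _)
  rw [mul_div_assoc', le_div_iff₀ hn0] at key
  nlinarith

/-- For the identity as conjugacy one differing index suffices, since already η ≤ η/(n + 2) is
absurd. -/
theorem eq_of_act_eq (hS : IsRun S) (hfree : ∀ k, k ≠ 0 → ∀ m : ℤ, pair k α ≠ m) (hd : 1 ≤ d)
    (ha : IsLimit S α a U φ) (hb : IsLimit S α b U' φ) : a = b := by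
  funext n
  by_contra hn
  obtain ⟨t, ht⟩ := ha.exists_eq_add hfree hd hb (h := 1) fun k => by simp
  obtain ⟨η, hη, hη1, x, y, hxy, hxy'⟩ := ha.exists_distorted hS hb hn t
  rw [← ht, ← ht] at hxy
  have h2 := hxy.trans hxy'
  have hn0 : (0 : ℝ) < n + 2 := by positivity
  have hle1 : η / (n + 2) ≤ 1 := by
    rw [div_le_one hn0]
    linarith [(Nat.cast_nonneg n : (0 : ℝ) ≤ n)]
  have h3 := h2.trans (pow_le_of_le_one (by positivity) hle1 (Nat.succ_ne_zero n))
  rw [le_div_iff₀ hn0] at h3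
  nlinarith [(Nat.cast_nonneg n : (0 : ℝ) ≤ n)]

/-- The n-th approximation depends on finitely many symbols, hence is locally constant in a, and the
convergence is uniform in a. -/
theorem continuous {U : (ℕ → Bool) → CircleDeg1Liftˣ} {Φ : (ℕ → Bool) → FreeAction d}
    (hΦ : ∀ a, IsLimit S α a (U a) (Φ a)) : Continuous Φ := by
  refine continuous_induced_rng.2 (continuous_pi fun k => ?_)
  have hunif : TendstoUniformly
      (fun n a => toDiffeo (conjShift (conjMap S a n) k (S (n + 1)).θ))
      (fun a => (Φ a).act k) atTop := by
    rw [Metric.tendstoUniformly_iff]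
    intro ε hε
    obtain ⟨N, hN⟩ := exists_mem_box k
    filter_upwards [tendsto_six_mul_pow.eventually (gt_mem_nhds hε), eventually_ge_atTop N]
      with n hn hNn a
    exact ((hΦ a).dist_act n k (hN n hNn)).trans_lt hn
  refine hunif.continuous (Frequently.of_forall fun n => ?_)
  exact ((isLocallyConstant_conjMap S n).comp fun A =>
    toDiffeo (conjShift A k (S (n + 1)).θ)).continuous

end IsLimit

end

end CircleActions

theorem mainTheorem6 (d : ℕ) (hd : 1 ≤ d) :
    ∃ Φ : (ℕ → Bool) → CircleActions.FreeAction d,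
      Continuous Φ ∧ Function.Injective Φ ∧
      (∀ a b : ℕ → Bool, (∃ N, ∀ n, N ≤ n → a n = b n) → (Φ a).SmoothConj (Φ b)) ∧
      (∀ a b : ℕ → Bool, {n | a n ≠ b n}.Infinite → ¬ (Φ a).HolderConj (Φ b)) ∧
      ∃ (D : CircleActions.AbCData d) (α : Fin d → ℝ),
        LinearIndependent ℚ (Fin.cons 1 α : Fin (d + 1) → ℝ) ∧
        (∀ i, Filter.Tendsto (D.angle i) Filter.atTop (nhds (α i))) ∧
        ∀ (a : ℕ → Bool) (i : Fin d),
          Filter.Tendsto (D.approx a i) Filter.atTop (nhds ((Φ a).generator i)) ∧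
          CircleActions.HasRotationNumber ((Φ a).generator i) (α i : CircleActions.S1) := by
  obtain ⟨S, hS⟩ := CircleActions.exists_isRun d
  obtain ⟨α, hα, hball⟩ := hS.exists_angle
  have hfree := hS.pair_ne_int hball
  choose U Φ hΦ using hS.exists_isLimit hα hfree
  refine ⟨Φ, CircleActions.IsLimit.continuous hΦ, fun a b hab => ?_,
    fun a b => (hΦ a).smoothConj (hΦ b), fun a b => (hΦ a).not_holderConj hS hfree hd (hΦ b),
    hS.data, α, CircleActions.linearIndependent_of_pair_ne_int hfree, fun i => ?_,
    fun a i => ⟨(hΦ a).tendsto_approx hS i, (hΦ a).hasRotationNumber i⟩⟩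
  · exact (hΦ a).eq_of_act_eq hS hfree hd (by rw [hab]; exact hΦ b)
  · exact ((tendsto_pi_nhds.1 hα) i).comp (tendsto_add_atTop_nat 1)
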